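/- **Setting.** Let $\chi$ be a topological space with its Borel $\sigma$-algebra and a $\sigma$-finite measure $\nu$, let $\Theta\subset\mathbb R^d$ be compact and $\mu$ a $\sigma$-finite Borel measure on $\mathbb R^d$. Let $\widehat\Theta\supseteq\Theta$ be closed and convex, $\Theta_H\subset\widehat\Theta$ a finite set, $\chi_c\subset\chi$ a compact set, and let $p(x|\theta)\ge 0$ be a jointly measurable kernel such that $p(\cdot|\theta)$ is a probability density with respect to $\nu$ for every $\theta\in\widehat\Theta$. For a probability distribution $F$ on $\Theta$ put $m_F(x)=\int_\Theta p(x|\theta)\,dF(\theta)$. Let $f$ be a probability density on $\Theta$ with respect to $\mu$, $F(d\theta)=f(\theta)\mu(d\theta)$ and $m=m_F$. Let $f_0$ be a probability density on $\Theta$ with respect to $\mu$ with $K_0=\int_\Theta f\log(f/f_0)\,d\mu<\infty$ (in particular $f=0$ $\mu$-almost everywhere on $\Theta$ where $f_0=0$). Let $q\ge 1$ and let $X_1,X_2,\dots$ be a $(q-1)$-dependent sequence of $\chi$-valued random variables, that is, for every $i\ge1$ the past $(X_1,\dots,X_i)$ is independent of the future $(X_j)_{j\ge i+q}$, such that every $X_i$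 has density $m$ with respect to $\nu$. Given weights $w_1,w_2,\dots\in(0,1)$, the predictive recursion is $$f_i(\theta)=(1-w_i)f_{i-1}(\theta)+w_i\,\frac{p(X_i|\theta)f_{i-1}(\theta)}{m_{i-1}(X_i)},\qquad m_{i-1}(x)=\int_\Theta p(x|\theta)f_{i-1}(\theta)\,\mu(d\theta),\qquad i\ge 1,$$ and $F_n(d\theta)=f_n(\theta)\mu(d\theta)$ on $\Theta$. Likelihood ratios take values in $[0,\infty]$, with $a/0=\infty$ for $a>0$ and $0/0=0$. **Theorem.** Assume: - (A1) $w_n\downarrow0$; $\sum_{i\ge1}w_{j+iq}=\infty$ for $j=1,\dots,q$; and $\sum_{i\ge1}w_i^2<\infty$. - (A2) The map $G\mapsto m_G$ is injective, as a map from probability distributions on $\Theta$ to densities up to $\nu$-almost everywhere equality. - (A3) For every $x\in\chi$ the map $\theta\mapsto p(x|\theta)$ is bounded and continuous on $\Theta$. - (A4) There is $B>0$ with $\int\big\{\frac{p(x|\theta_1)}{p(x|\theta_2)}\big\}^k p(x|\theta_3)\,\nu(dx)<B$ for all $\theta_1,\theta_2\in\Theta\cup\Theta_H$, all $\theta_3\in\Theta$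 and all integers $0\le k\le 4q$. - (C1) There is $c_u>1$ such that for every $x\notin\chi_c$ there are $\theta_1^x,\theta_2^x\in\Theta_H$ with $\sup_{\theta,\theta'\in\Theta}\frac{p(x|\theta)}{p(x|\theta')}\le c_u\frac{p(x|\theta_2^x)}{p(x|\theta_1^x)}$. - (C2) There is $a>0$ with $p(x|\theta)\ge a$ for all $x\in\chi_c$, $\theta\in\Theta$. - (C3) There is $b<\infty$ with $p(x|\theta)\le b$ for all $x\in\chi_c$, $\theta\in\Theta$. Then, with probability one, every $F_n$ is a probability distribution and $F_n$ converges weakly to $F$ as $n\to\infty$. -/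

import Mathlib

open MeasureTheory ProbabilityTheory Filter Topology
open scoped ENNReal NNReal

namespace PredictiveRecursion

/-- The (unnormalised) mixing distribution on `Θ` with density `f` with respect to `μ`:
`F(dθ) = 1_Θ(θ) f(θ) μ(dθ)`. -/
noncomputable def mixingMeasure {E : Type*} [MeasurableSpace E] (μ : Measure E) (Θ : Set E)
    (f : E → ℝ≥0∞) : Measure E :=
  (μ.restrict Θ).withDensity f

/-- The mixture (marginal) density `m_F(x) = ∫ p(x|θ) dF(θ)`; the kernel `p(x|θ)` is `p θ x`. -/
noncomputable def mixture {E χ : Type*} [MeasurableSpace E] (p : E → χ → ℝ≥0) (F : Measure E)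
    (x : χ) : ℝ≥0∞ :=
  ∫⁻ θ, (p θ x : ℝ≥0∞) ∂F

/-- The mixing densities `f_0, f_1, f_2, …` produced by the predictive recursion with weights
`w 1, w 2, …` from the observations `x 1, x 2, …` and the initial density `f0`:
`f_i(θ) = (1 - w_i) f_{i-1}(θ) + w_i p(x_i|θ) f_{i-1}(θ) / m_{i-1}(x_i)`, where
`m_{i-1}(x) = ∫_Θ p(x|θ) f_{i-1}(θ) μ(dθ)`. -/
noncomputable def prDensity {E χ : Type*} [MeasurableSpace E] (μ : Measure E) (Θ : Set E)
    (p : E → χ → ℝ≥0) (w : ℕ → ℝ) (f0 : E → ℝ≥0∞) (x : ℕ → χ) : ℕ → E → ℝ≥0∞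
  | 0 => f0
  | n + 1 => fun θ =>
      ENNReal.ofReal (1 - w (n + 1)) * prDensity μ Θ p w f0 x n θ
        + ENNReal.ofReal (w (n + 1)) *
          (p θ (x (n + 1)) * prDensity μ Θ p w f0 x n θ
            / mixture p (mixingMeasure μ Θ (prDensity μ Θ p w f0 x n)) (x (n + 1)))

/-- `X 1, X 2, …` is `M`-dependent: for every `i ≥ 1` the past `(X 1, …, X i)` is independent of
the future `(X j : j > i + M)`. -/
def IsMDependent {Ω χ : Type*} [MeasurableSpace Ω] [MeasurableSpace χ] (X : ℕ → Ω → χ) (M : ℕ)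
    (P : Measure Ω) : Prop :=
  ∀ i : ℕ, 1 ≤ i →
    Indep (⨆ j : {j : ℕ // 1 ≤ j ∧ j ≤ i}, MeasurableSpace.comap (X j) inferInstance)
      (⨆ j : {j : ℕ // i + M < j}, MeasurableSpace.comap (X j) inferInstance) P

/-- Weights `w 1, w 2, …` in `(0, 1)`, decreasing to `0`, with divergent sum along every residue
class modulo `q`, and square summable. -/
def WeightCondition (q : ℕ) (w : ℕ → ℝ) : Prop :=
  (∀ i, 1 ≤ i → 0 < w i ∧ w i < 1) ∧
  (∀ i j, 1 ≤ i → i ≤ j → w j ≤ w i) ∧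
  Tendsto w atTop (𝓝 0) ∧
  (∀ j, 1 ≤ j → j ≤ q → ¬ Summable fun i : ℕ => w (j + (i + 1) * q)) ∧
  Summable fun i : ℕ => w (i + 1) ^ 2

/-- Identifiability: the map `F ↦ m_F`, from probability distributions on `Θ` to densities with
respect to `ν` (taken up to `ν`-almost everywhere equality), is injective. -/
def Identifiable {E χ : Type*} [MeasurableSpace E] [MeasurableSpace χ] (ν : Measure χ)
    (Θ : Set E) (p : E → χ → ℝ≥0) : Prop :=
  ∀ F G : Measure E, IsProbabilityMeasure F → IsProbabilityMeasure G →
    F Θᶜ = 0 → G Θᶜ = 0 → mixture p F =ᵐ[ν] mixture p G → F = G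

/-- For every `x`, the map `θ ↦ p(x|θ)` is bounded and continuous on `Θ`. -/
def KernelContinuous {E χ : Type*} [TopologicalSpace E] (Θ : Set E) (p : E → χ → ℝ≥0) : Prop :=
  ∀ x, (∃ C : ℝ≥0, ∀ θ ∈ Θ, p θ x ≤ C) ∧ ContinuousOn (fun θ => p θ x) Θ

/-- Uniform bound on the moments of likelihood ratios up to the power `4q`. The ratios are
formed over the parameters in `Θ` and in the finite reference set `ΘH`; they take values in
`[0, ∞]`, with `a / 0 = ∞` for `a > 0` and `0 / 0 = 0`. -/
def RatioMoments {E χ : Type*} [MeasurableSpace χ] (ν : Measure χ) (Θ : Set E) (ΘH : Finset E)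
    (p : E → χ → ℝ≥0) (q : ℕ) : Prop :=
  ∃ B : ℝ≥0, 0 < B ∧ ∀ k : ℕ, k ≤ 4 * q →
    ∀ θ₁ ∈ Θ ∪ ΘH, ∀ θ₂ ∈ Θ ∪ ΘH, ∀ θ₃ ∈ Θ,
      ∫⁻ x, ((p θ₁ x : ℝ≥0∞) / (p θ₂ x : ℝ≥0∞)) ^ k * (p θ₃ x : ℝ≥0∞) ∂ν < B

/-- Outside `χc`, all likelihood ratios over `Θ` are bounded, up to a constant factor, by a single
likelihood ratio between two points of the finite set `ΘH`. -/
def RatioDomination {E χ : Type*} (Θ : Set E) (ΘH : Finset E) (χc : Set χ)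
    (p : E → χ → ℝ≥0) : Prop :=
  ∃ cu : ℝ≥0, 1 < cu ∧ ∀ x, x ∉ χc → ∃ θ₁ ∈ ΘH, ∃ θ₂ ∈ ΘH, ∀ θ ∈ Θ, ∀ θ' ∈ Θ,
    (p θ x : ℝ≥0∞) / (p θ' x : ℝ≥0∞) ≤ cu * ((p θ₂ x : ℝ≥0∞) / (p θ₁ x : ℝ≥0∞))

end PredictiveRecursion

/-! The density of $F_n$ with respect to $F_0$ is the product of the factors $1+w_i(\rho_i-1)$,
$\rho_i(\theta)=p(X_i|\theta)/m_{i-1}(X_i)$. Since $F_n$ has mass one, Gibbs' inequality bounds the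
$F$-integral of the logarithm of this product by $K_0$. A second-order lower bound for the logarithm
turns this into a bound along each regular path (`sum_le_toReal_klDiv`): $\sum
w_i(m(X_i)/m_{i-1}(X_i)-1)\le K_0+C\sum w_i^2(1+R(X_i))^2$. Here $R$ dominates all likelihood ratios
over $\Theta$ and has finite second moment under $m$, by (A4) and (C1)-(C3) (`exists_ratio_bound`).

The observation $X_i$ may depend on $m_{i-1}$ but not on $m_{i-q}$. Going back from $m_{i-1}$ to
$m_{i-q}$ changes the ratio by $O(w_{i-q}R(X_i)^2)$, so it costs only another square-summable term
(`sum_delayed_le`). Integrating out $X_i$ then leaves $\int m^2/m_{i-q}\,d\nu\ge 1+\delta_{i-q}^2$,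
where $\delta_n=\int(m-m_n)^+d\nu$ is the total variation distance (`one_add_sq_le_lintegral_div`).
Hence $\sum w_i\,E\,\delta_{i-q}^2<\infty$, and $\sum w_i\delta_{i-q}^2<\infty$ almost surely.

One step moves $\delta_n$ by at most the weight, so divergence of $\sum w_i$ and convergence of
$\sum w_i^2$ force $\delta_n\to0$ (`tendsto_prDist`). Distributions on the compact $\Theta$ form a
compact set, and by Fatou and identifiability $F$ is the only cluster point of $F_n$
(`tendsto_of_tendsto_lintegral_tsub`). -/

namespace PredictiveRecursion

/-! ### A real-sequence lemma and Gibbs' inequality -/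

/-- A nonnegative sequence with increments `O(w n)` and `∑ w n * b n < ∞` tends to zero when
`∑ w n = ∞` and `∑ (w n)² < ∞`. -/
theorem tendsto_zero_of_summable_mul {w b : ℕ → ℝ} {C : ℝ} (hC : 0 ≤ C) (hw : ∀ n, 0 ≤ w n)
    (hw2 : Summable fun n => w n ^ 2) (hdiv : ¬ Summable w) (hb : ∀ n, 0 ≤ b n)
    (hinc : ∀ n, |b (n + 1) - b n| ≤ C * w n) (hs : Summable fun n => w n * b n) :
    Tendsto b atTop (𝓝 0) := by
  -- The increments of `b` are only `O(w n)`, not summable; those of `b²` gain a factor `b n` or `w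
  -- n` and are summable.
  have hcs : CauchySeq fun n => b n ^ 2 := by
    apply cauchySeq_of_summable_dist
    refine Summable.of_nonneg_of_le (fun _ => dist_nonneg) (fun n => ?_)
      ((hs.mul_left (2 * C)).add (hw2.mul_left (C ^ 2)))
    rw [dist_comm, Real.dist_eq,
      show b (n + 1) ^ 2 - b n ^ 2 = (b (n + 1) - b n) * (2 * b n + (b (n + 1) - b n)) by ring,
      abs_mul]
    have h1 := hinc n
    have h2 : |2 * b n + (b (n + 1) - b n)| ≤ 2 * b n + C * w n :=
      (abs_add_le _ _).trans (add_le_add (le_of_eq (abs_of_nonneg (by linarith [hb n]))) h1)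
    calc _ ≤ (C * w n) * (2 * b n + C * w n) :=
          mul_le_mul h1 h2 (abs_nonneg _) (mul_nonneg hC (hw n))
      _ = _ := by ring
  obtain ⟨L, hL⟩ := cauchySeq_tendsto_of_complete hcs
  have hlim : Tendsto b atTop (𝓝 (√L)) := by
    simpa [Function.comp_def, Real.sqrt_sq (hb _)] using (Real.continuous_sqrt.tendsto L).comp hL
  rcases (Real.sqrt_nonneg L).eq_or_lt with h0 | hpos
  · rwa [← h0] at hlim
  · exfalso
    apply hdiv
    have hev : ∀ᶠ n in atTop, √L / 2 ≤ b n :=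
      (hlim.eventually (lt_mem_nhds (half_lt_self hpos))).mono fun _ h => h.le
    refine Summable.of_norm_bounded_eventually_nat (hs.mul_left (2 / √L)) ?_
    filter_upwards [hev] with n hn
    rw [Real.norm_of_nonneg (hw n)]
    calc w n = 2 / √L * (w n * (√L / 2)) := by field_simp
      _ ≤ _ := by gcongr; exact hw n

/-- Gibbs' variational inequality for the Kullback-Leibler divergence. -/
theorem integral_le_toReal_klDiv {α : Type*} [MeasurableSpace α] {F F0 : Measure α}
    [IsProbabilityMeasure F] [IsProbabilityMeasure F0]
    (hkl : InformationTheory.klDiv F F0 ≠ ∞) {g : α → ℝ} (hg : Integrable g F)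
    {h : α → ℝ≥0∞} (hm : Measurable h)
    (hgh : ∀ᵐ a ∂F, ENNReal.ofReal (Real.exp (g a)) ≤ h a) (h1 : ∫⁻ a, h a ∂F0 ≤ 1) :
    ∫ a, g a ∂F ≤ (InformationTheory.klDiv F F0).toReal := by
  obtain ⟨hac, hint⟩ := InformationTheory.klDiv_ne_top_iff.1 hkl
  rw [InformationTheory.toReal_klDiv_of_measure_eq hac (by simp)]
  set D := F.rnDeriv F0 with hD
  have hDm : Measurable D := Measure.measurable_rnDeriv _ _
  -- Only an inequality: the part of `h` where `D = 0` is lost.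
  have hle : ∫⁻ a, h a * (D a)⁻¹ ∂F ≤ 1 := by
    have heq : ∫⁻ a, h a * (D a)⁻¹ ∂F = ∫⁻ a, (D * (h * D⁻¹)) a ∂F0 := by
      conv_lhs => rw [← Measure.withDensity_rnDeriv_eq F F0 hac]
      exact lintegral_withDensity_eq_lintegral_mul _ hDm (hm.mul hDm.inv)
    rw [heq]
    refine le_trans (lintegral_mono fun a => ?_) h1
    change D a * (h a * (D a)⁻¹) ≤ h a
    rw [mul_left_comm]
    exact mul_le_of_le_one_right' (ENNReal.mul_inv_le_one _)
  have hφm : Measurable fun a => h a * (D a)⁻¹ := hm.mul hDm.inv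
  have hne : ∫⁻ a, h a * (D a)⁻¹ ∂F ≠ ∞ := (hle.trans_lt ENNReal.one_lt_top).ne
  have hφi : Integrable (fun a => (h a * (D a)⁻¹).toReal) F :=
    integrable_toReal_of_lintegral_ne_top hφm.aemeasurable hne
  have hφ1 : ∫ a, (h a * (D a)⁻¹).toReal ∂F ≤ 1 := by
    rw [integral_toReal hφm.aemeasurable (ae_lt_top hφm hne)]
    exact ENNReal.toReal_le_of_le_ofReal zero_le_one (by simpa using hle)
  -- This is `log t ≤ t - 1` at `t = exp (g a) / D a`; integrated, the last term is at most zero.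
  have hpt : ∀ᵐ a ∂F, g a ≤ llr F F0 a + ((h a * (D a)⁻¹).toReal - 1) := by
    filter_upwards [hgh, Measure.rnDeriv_pos hac, hac.ae_le (Measure.rnDeriv_lt_top F F0),
      ae_lt_top hφm hne] with a ha hpos hlt hφ
    have hd : 0 < (D a).toReal := ENNReal.toReal_pos hpos.ne' hlt.ne
    have h2 : Real.exp (g a) / (D a).toReal ≤ (h a * (D a)⁻¹).toReal := by
      rw [div_eq_mul_inv, ← ENNReal.toReal_inv, ← ENNReal.toReal_ofReal (Real.exp_nonneg (g a)),
        ← ENNReal.toReal_mul]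
      exact ENNReal.toReal_mono hφ.ne (mul_le_mul_left ha _)
    have h3 := Real.log_le_sub_one_of_pos (div_pos (Real.exp_pos (g a)) hd)
    rw [Real.log_div (Real.exp_pos _).ne' hd.ne', Real.log_exp] at h3
    simp only [llr]
    change g a ≤ Real.log (D a).toReal + _
    linarith
  calc ∫ a, g a ∂F ≤ ∫ a, (llr F F0 a + ((h a * (D a)⁻¹).toReal - 1)) ∂F :=
        integral_mono_ae hg (hint.add (hφi.sub (integrable_const 1))) hpt
    _ = ∫ a, llr F F0 a ∂F + (∫ a, (h a * (D a)⁻¹).toReal ∂F - 1) := by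
        have h4 : Integrable (fun a => (h a * (D a)⁻¹).toReal - 1) F :=
          hφi.sub (integrable_const 1)
        rw [integral_add hint h4, integral_sub hφi (integrable_const 1)]
        simp
    _ ≤ _ := by linarith

/-! ### Mixture densities and Tonelli -/

section Mixture

variable {E χ : Type*} [MeasurableSpace E] [MeasurableSpace χ] {p : E → χ → ℝ≥0}

theorem measurable_mixture (hp : Measurable (Function.uncurry p)) (F : Measure E) [SFinite F] :
    Measurable (mixture p F) :=
  Measurable.lintegral_prod_left' (f := fun z : E × χ => (p z.1 z.2 : ℝ≥0∞))
    hp.coe_nnreal_ennreal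

theorem lintegral_mul_mixture (hp : Measurable (Function.uncurry p)) (F : Measure E) [SFinite F]
    (ν : Measure χ) [SFinite ν] {g : χ → ℝ≥0∞} (hg : Measurable g) :
    ∫⁻ y, g y * mixture p F y ∂ν = ∫⁻ θ, ∫⁻ y, g y * p θ y ∂ν ∂F := by
  have hm : Measurable fun z : E × χ => g z.2 * (p z.1 z.2 : ℝ≥0∞) :=
    (hg.comp measurable_snd).mul hp.coe_nnreal_ennreal
  rw [lintegral_lintegral_swap hm.aemeasurable]
  refine lintegral_congr fun y => ?_
  rw [mixture, lintegral_const_mul]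
  exact (hp.comp measurable_prodMk_right).coe_nnreal_ennreal

theorem ae_mem_of_compl_null {F : Measure E} {Θ : Set E} (h : F Θᶜ = 0) : ∀ᵐ θ ∂F, θ ∈ Θ :=
  mem_ae_iff.2 h

theorem lintegral_mixture (hp : Measurable (Function.uncurry p)) (F : Measure E)
    [IsProbabilityMeasure F] (ν : Measure χ) [SFinite ν] {Θ : Set E} (hF : F Θᶜ = 0)
    (h1 : ∀ θ ∈ Θ, ∫⁻ x, (p θ x : ℝ≥0∞) ∂ν = 1) :
    ∫⁻ y, mixture p F y ∂ν = 1 := by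
  have := lintegral_mul_mixture hp F ν (g := fun _ => 1) measurable_const
  simp only [one_mul] at this
  rw [this, lintegral_congr_ae ((ae_mem_of_compl_null hF).mono fun θ hθ => h1 θ hθ)]
  simp

end Mixture

/-! ### From total variation of mixtures to weak convergence of mixing distributions -/

section Weak

variable {E χ : Type*} [MetricSpace E] [MeasurableSpace E]
  {p : E → χ → ℝ≥0} {Θ : Set E}

/-- Mixtures of a kernel that is bounded and continuous on the closed set `Θ` are continuous in
the mixing distribution, for the weak topology on distributions carried by `Θ`. -/
theorem tendsto_mixture [BorelSpace E] (hΘ : IsClosed Θ) (hcont : KernelContinuous Θ p)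
    {ι : Type*} {l : Filter ι} {Fs : ι → ProbabilityMeasure E} {G : ProbabilityMeasure E}
    (hFs : ∀ i, (Fs i : Measure E) Θᶜ = 0) (hG : (G : Measure E) Θᶜ = 0)
    (hlim : Tendsto Fs l (𝓝 G)) (y : χ) :
    Tendsto (fun i => mixture p (Fs i : Measure E) y) l (𝓝 (mixture p (G : Measure E) y)) := by
  obtain ⟨⟨C, hC⟩, hc⟩ := hcont y
  -- The kernel is continuous only on `Θ`: Tietze extends it, and truncation to `[0, C]` makes the
  -- extension a bounded test function without changing it on `Θ`.
  obtain ⟨g, hg⟩ := ContinuousMap.exists_restrict_eq hΘ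
    (⟨fun θ : Θ => (p θ y : ℝ), NNReal.continuous_coe.comp hc.domRestrict⟩ : C(Θ, ℝ))
  let φ : BoundedContinuousFunction E ℝ≥0 :=
    BoundedContinuousFunction.mkOfBound
      ⟨fun θ => min (g θ).toNNReal C, (continuous_real_toNNReal.comp g.continuous).min
        continuous_const⟩ C (fun a b => by
          rw [NNReal.dist_eq]
          have h1 : ((min (g a).toNNReal C : ℝ≥0) : ℝ) ≤ C := NNReal.coe_le_coe.2 (min_le_right _ _)
          have h2 : ((min (g b).toNNReal C : ℝ≥0) : ℝ) ≤ C := NNReal.coe_le_coe.2 (min_le_right _ _)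
          exact abs_sub_le_of_nonneg_of_le (NNReal.coe_nonneg _) h1 (NNReal.coe_nonneg _) h2)
  have hφ : ∀ θ ∈ Θ, φ θ = p θ y := fun θ hθ => by
    have h1 : g θ = p θ y := congr($hg ⟨θ, hθ⟩)
    change min (g θ).toNNReal C = _
    rw [h1, Real.toNNReal_coe, min_eq_left (hC θ hθ)]
  have hmix : ∀ H : ProbabilityMeasure E, (H : Measure E) Θᶜ = 0 →
      mixture p (H : Measure E) y = ∫⁻ θ, φ θ ∂(H : Measure E) := fun H hH =>
    lintegral_congr_ae ((ae_mem_of_compl_null hH).mono fun θ hθ => by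
      simp only [hφ θ hθ])
  simp only [hmix _ hG, hmix _ (hFs _)]
  exact ProbabilityMeasure.tendsto_iff_forall_lintegral_tendsto.1 hlim φ

theorem mixture_lt_top (hcont : KernelContinuous Θ p) (F : Measure E) [IsProbabilityMeasure F]
    (hF : F Θᶜ = 0) (y : χ) : mixture p F y < ∞ := by
  obtain ⟨⟨C, hC⟩, -⟩ := hcont y
  calc mixture p F y ≤ ∫⁻ _, (C : ℝ≥0∞) ∂F :=
        lintegral_mono_ae ((ae_mem_of_compl_null hF).mono fun θ hθ =>
          ENNReal.coe_le_coe.2 (hC θ hθ))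
    _ < ∞ := by simp

/-- Convergence of the mixture densities in total variation implies weak convergence of the mixing
distributions, when the mixing distribution is identifiable. -/
theorem tendsto_of_tendsto_lintegral_tsub [BorelSpace E] [SecondCountableTopology E]
    [MeasurableSpace χ] (ν : Measure χ) [SFinite ν]
    (hΘ : IsCompact Θ) (hp : Measurable (Function.uncurry p))
    (h1 : ∀ θ ∈ Θ, ∫⁻ x, (p θ x : ℝ≥0∞) ∂ν = 1) (hcont : KernelContinuous Θ p)
    (hid : Identifiable ν Θ p) {Fs : ℕ → ProbabilityMeasure E} {F : ProbabilityMeasure E}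
    (hFs : ∀ i, (Fs i : Measure E) Θᶜ = 0) (hF : (F : Measure E) Θᶜ = 0)
    (hlim : Tendsto (fun n => ∫⁻ y, (mixture p (F : Measure E) y
      - mixture p (Fs n : Measure E) y) ∂ν) atTop (𝓝 0)) :
    Tendsto Fs atTop (𝓝 F) := by
  -- Prokhorov, with tightness in the degenerate form of the constant compact `Θ` and the constant
  -- bound `0`.
  have hK : IsCompact {G : ProbabilityMeasure E | ∀ _ : ℕ, G Θᶜ ≤ 0} :=
    isCompact_setOfPred_probabilityMeasure_mass_eq_compl_isCompact_le (u := fun _ => 0)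
      (K := fun _ => Θ) tendsto_const_nhds (fun _ => hΘ) (Or.inr monotone_const)
  have hnull : ∀ G : ProbabilityMeasure E, G Θᶜ = 0 ↔ (G : Measure E) Θᶜ = 0 := fun G =>
    ProbabilityMeasure.null_iff_toMeasure_null G _
  refine hK.tendsto_nhds_of_unique_mapClusterPt
    (Eventually.of_forall fun n _ => ((hnull _).2 (hFs n)).le) fun G hG hcl => ?_
  have hG0 : (G : Measure E) Θᶜ = 0 := (hnull _).1 (le_antisymm (hG 0) zero_le)
  obtain ⟨φ, hφ, hφlim⟩ := hcl.tendsto_subseq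
  have hpt : ∀ y, Tendsto (fun n => mixture p (F : Measure E) y
      - mixture p (Fs (φ n) : Measure E) y) atTop
      (𝓝 (mixture p (F : Measure E) y - mixture p (G : Measure E) y)) := fun y =>
    ENNReal.Tendsto.sub tendsto_const_nhds
      (tendsto_mixture hΘ.isClosed hcont (fun n => hFs (φ n)) hG0 hφlim y)
      (Or.inl (mixture_lt_top hcont _ hF y).ne)
  have hmF := measurable_mixture hp (F : Measure E)
  have hmG := measurable_mixture hp (G : Measure E)
  -- Fatou along the subsequence. The positive part suffices, since `m_F ≤ m_G` between functions of
  -- integral one is equality.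
  have hzero : ∫⁻ y, (mixture p (F : Measure E) y - mixture p (G : Measure E) y) ∂ν = 0 := by
    refine le_antisymm ?_ zero_le
    calc _ = ∫⁻ y, liminf (fun n => mixture p (F : Measure E) y
          - mixture p (Fs (φ n) : Measure E) y) atTop ∂ν :=
          lintegral_congr fun y => ((hpt y).liminf_eq).symm
      _ ≤ liminf (fun n => ∫⁻ y, (mixture p (F : Measure E) y
          - mixture p (Fs (φ n) : Measure E) y) ∂ν) atTop :=
          lintegral_liminf_le fun n => hmF.sub (measurable_mixture hp _)
      _ = 0 := (hlim.comp hφ.tendsto_atTop).liminf_eq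
  have hle : mixture p (F : Measure E) ≤ᵐ[ν] mixture p (G : Measure E) := by
    filter_upwards [(lintegral_eq_zero_iff (hmF.sub hmG)).1 hzero] with y hy
    exact tsub_eq_zero_iff_le.1 hy
  have heq : mixture p (F : Measure E) =ᵐ[ν] mixture p (G : Measure E) :=
    ae_eq_of_ae_le_of_lintegral_le hle (by simp [lintegral_mixture hp _ ν hF h1])
      hmG.aemeasurable (by rw [lintegral_mixture hp _ ν hF h1, lintegral_mixture hp _ ν hG0 h1])
  exact (Subtype.ext (hid F G inferInstance inferInstance hF hG0 heq)).symm

end Weak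

/-! ### Points with bounded likelihood ratios; posteriors -/

section Kernel

variable {E χ : Type*} [MeasurableSpace E] {p : E → χ → ℝ≥0} {Θ : Set E}

/-- At the point `y` the kernel is positive on `Θ` and its likelihood ratios are at most `r`. -/
structure BoundedRatio (Θ : Set E) (p : E → χ → ℝ≥0) (r : ℝ≥0) (y : χ) : Prop where
  pos : ∀ θ ∈ Θ, 0 < p θ y
  le_mul : ∀ θ ∈ Θ, ∀ θ' ∈ Θ, p θ y ≤ r * p θ' y

namespace BoundedRatio

variable {r : ℝ≥0} {y : χ}

theorem le_mul_mixture (h : BoundedRatio Θ p r y) (F : Measure E) [IsProbabilityMeasure F]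
    (hF : F Θᶜ = 0) (hy : Measurable fun θ => p θ y) {θ : E} (hθ : θ ∈ Θ) :
    (p θ y : ℝ≥0∞) ≤ r * mixture p F y := by
  rw [mixture, ← lintegral_const_mul _ hy.coe_nnreal_ennreal]
  calc (p θ y : ℝ≥0∞) = ∫⁻ _, (p θ y : ℝ≥0∞) ∂F := by simp
    _ ≤ _ := lintegral_mono_ae ((ae_mem_of_compl_null hF).mono fun θ' hθ' => by
      exact_mod_cast h.le_mul θ hθ θ' hθ')

theorem mixture_le_mul_mixture (h : BoundedRatio Θ p r y) (F G : Measure E)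
    [IsProbabilityMeasure F] [IsProbabilityMeasure G] (hF : F Θᶜ = 0) (hG : G Θᶜ = 0)
    (hy : Measurable fun θ => p θ y) : mixture p F y ≤ r * mixture p G y := by
  calc mixture p F y ≤ ∫⁻ _, r * mixture p G y ∂F :=
        lintegral_mono_ae ((ae_mem_of_compl_null hF).mono fun θ hθ =>
          h.le_mul_mixture G hG hy hθ)
    _ = _ := by simp

theorem mixture_ne_zero (h : BoundedRatio Θ p r y) (F : Measure E) [IsProbabilityMeasure F]
    (hF : F Θᶜ = 0) (hy : Measurable fun θ => p θ y) : mixture p F y ≠ 0 := by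
  intro h0
  obtain ⟨θ, hθ⟩ := (ae_mem_of_compl_null hF).exists
  have := h.le_mul_mixture F hF hy hθ
  rw [h0, mul_zero] at this
  exact (ENNReal.coe_pos.2 (h.pos θ hθ)).not_ge this

theorem mixture_ne_top (h : BoundedRatio Θ p r y) (F : Measure E) [IsProbabilityMeasure F]
    (hF : F Θᶜ = 0) : mixture p F y ≠ ∞ := by
  obtain ⟨θ, hθ⟩ := (ae_mem_of_compl_null hF).exists
  refine ne_top_of_le_ne_top (b := ∫⁻ _, (r * p θ y : ℝ≥0) ∂F)
    (by rw [lintegral_const]; finiteness) ?_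
  exact lintegral_mono_ae ((ae_mem_of_compl_null hF).mono fun θ' hθ' => by
      exact_mod_cast h.le_mul θ' hθ' θ hθ)

end BoundedRatio

theorem mixture_add (F G : Measure E) (y : χ) :
    mixture p (F + G) y = mixture p F y + mixture p G y :=
  lintegral_add_measure _ _ _

theorem mixture_smul (c : ℝ≥0∞) (F : Measure E) (y : χ) :
    mixture p (c • F) y = c * mixture p F y :=
  lintegral_smul_measure _ _

/-- The posterior distribution for the prior `F` after the observation `y`. -/
noncomputable def posterior (p : E → χ → ℝ≥0) (F : Measure E) (y : χ) : Measure E :=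
  F.withDensity fun θ => p θ y / mixture p F y

theorem posterior_compl {F : Measure E} (hF : F Θᶜ = 0) (y : χ) : posterior p F y Θᶜ = 0 :=
  withDensity_absolutelyContinuous _ _ hF

theorem isProbabilityMeasure_posterior {F : Measure E} {y : χ} (hy : Measurable fun θ => p θ y)
    (h0 : mixture p F y ≠ 0) (ht : mixture p F y ≠ ∞) :
    IsProbabilityMeasure (posterior p F y) := by
  constructor
  simp_rw [posterior, withDensity_apply _ MeasurableSet.univ, Measure.restrict_univ,
    div_eq_mul_inv]
  rw [lintegral_mul_const _ hy.coe_nnreal_ennreal]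
  exact ENNReal.mul_inv_cancel h0 ht

end Kernel

/-! ### The recursion as a sequence of probability measures -/

section Recursion

variable {E χ : Type*} [MeasurableSpace E] {μ : Measure E} {Θ : Set E} {p : E → χ → ℝ≥0}
  {w : ℕ → ℝ} {f0 : E → ℝ≥0∞} {x : ℕ → χ}

/-- The mixing distribution after `n` steps of the predictive recursion. -/
noncomputable def prMeasure (μ : Measure E) (Θ : Set E) (p : E → χ → ℝ≥0) (w : ℕ → ℝ)
    (f0 : E → ℝ≥0∞) (x : ℕ → χ) (n : ℕ) : Measure E :=
  mixingMeasure μ Θ (prDensity μ Θ p w f0 x n)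

/-- Adaptedness: this is what allows an observation `q` steps ahead to be integrated out
independently. -/
theorem prDensity_congr {x x' : ℕ → χ} {n : ℕ} (h : ∀ i, 1 ≤ i → i ≤ n → x i = x' i) :
    prDensity μ Θ p w f0 x n = prDensity μ Θ p w f0 x' n := by
  induction n with
  | zero => rfl
  | succ n ih =>
    simp only [prDensity, ih fun i h1 h2 => h i h1 (h2.trans n.le_succ),
      h (n + 1) (Nat.le_add_left 1 n) le_rfl]

theorem mixingMeasure_compl (hΘ : MeasurableSet Θ) (f : E → ℝ≥0∞) :
    mixingMeasure μ Θ f Θᶜ = 0 :=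
  withDensity_absolutelyContinuous _ _ (by simp [hΘ.compl])

theorem measurable_prDensity (hp : ∀ y, Measurable fun θ => p θ y) (hf0 : Measurable f0) (n : ℕ) :
    Measurable (prDensity μ Θ p w f0 x n) := by
  induction n with
  | zero => exact hf0
  | succ n ih =>
    exact (ih.const_mul _).add
      ((((hp (x (n + 1))).coe_nnreal_ennreal.mul ih).div_const _).const_mul _)

/-- The factor by which the density changes in step `i + 1` of the recursion. -/
noncomputable def prFactor (μ : Measure E) (Θ : Set E) (p : E → χ → ℝ≥0) (w : ℕ → ℝ)
    (f0 : E → ℝ≥0∞) (x : ℕ → χ) (i : ℕ) (θ : E) : ℝ≥0∞ :=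
  ENNReal.ofReal (1 - w (i + 1)) + ENNReal.ofReal (w (i + 1)) *
    (p θ (x (i + 1)) / mixture p (prMeasure μ Θ p w f0 x i) (x (i + 1)))

theorem prDensity_succ (n : ℕ) (θ : E) : prDensity μ Θ p w f0 x (n + 1) θ =
    prDensity μ Θ p w f0 x n θ * prFactor μ Θ p w f0 x n θ := by
  simp only [prDensity, prFactor, prMeasure, div_eq_mul_inv]
  ring

theorem prDensity_eq_prod (n : ℕ) (θ : E) : prDensity μ Θ p w f0 x n θ =
    f0 θ * ∏ i ∈ Finset.range n, prFactor μ Θ p w f0 x i θ := by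
  induction n with
  | zero => simp [prDensity]
  | succ n ih => rw [prDensity_succ, ih, Finset.prod_range_succ, mul_assoc]

theorem measurable_prFactor (hp : ∀ y, Measurable fun θ => p θ y) (i : ℕ) :
    Measurable (prFactor μ Θ p w f0 x i) :=
  (((hp (x (i + 1))).coe_nnreal_ennreal.div_const _).const_mul _).const_add _

/-- A convex combination of the current distribution and its posterior: mass is preserved, and the
mixtures move by at most the weight. -/
theorem prMeasure_succ (hp : ∀ y, Measurable fun θ => p θ y) (hf0 : Measurable f0) (n : ℕ) :
    prMeasure μ Θ p w f0 x (n + 1) = ENNReal.ofReal (1 - w (n + 1)) • prMeasure μ Θ p w f0 x n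
      + ENNReal.ofReal (w (n + 1)) • posterior p (prMeasure μ Θ p w f0 x n) (x (n + 1)) := by
  have hm := measurable_prDensity (μ := μ) (Θ := Θ) (w := w) (x := x) hp hf0 n
  have hq : Measurable fun θ => (p θ (x (n + 1)) : ℝ≥0∞)
      / mixture p (prMeasure μ Θ p w f0 x n) (x (n + 1)) :=
    (hp (x (n + 1))).coe_nnreal_ennreal.div_const _
  have h1 : prDensity μ Θ p w f0 x (n + 1) =
      ENNReal.ofReal (1 - w (n + 1)) • prDensity μ Θ p w f0 x n
        + ENNReal.ofReal (w (n + 1)) • (prDensity μ Θ p w f0 x n * fun θ =>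
          (p θ (x (n + 1)) : ℝ≥0∞) / mixture p (prMeasure μ Θ p w f0 x n) (x (n + 1))) := by
    funext θ
    rw [prDensity_succ, prFactor]
    simp only [Pi.add_apply, Pi.smul_apply, Pi.mul_apply, smul_eq_mul]
    ring
  conv_lhs => rw [prMeasure, mixingMeasure, h1, withDensity_add_left (hm.const_smul _),
    withDensity_smul _ hm, withDensity_smul _ (hm.mul hq), withDensity_mul _ hm hq]
  rfl

/-- Identifies the product of the factors as a function of `F_0`-integral one, the `h` of Gibbs'
inequality. -/
theorem prMeasure_eq_withDensity (hp : ∀ y, Measurable fun θ => p θ y) (hf0 : Measurable f0)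
    (n : ℕ) : prMeasure μ Θ p w f0 x n = (mixingMeasure μ Θ f0).withDensity
      fun θ => ∏ i ∈ Finset.range n, prFactor μ Θ p w f0 x i θ := by
  have h1 : prDensity μ Θ p w f0 x n =
      f0 * fun θ => ∏ i ∈ Finset.range n, prFactor μ Θ p w f0 x i θ :=
    funext fun θ => prDensity_eq_prod n θ
  rw [prMeasure, mixingMeasure, h1, withDensity_mul _ hf0
    (Finset.measurable_fun_prod _ fun i _ => measurable_prFactor hp i)]
  rfl

theorem isProbabilityMeasure_prMeasure (hΘ : MeasurableSet Θ)
    (hp : ∀ y, Measurable fun θ => p θ y) (hf0 : Measurable f0)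
    (h0 : IsProbabilityMeasure (mixingMeasure μ Θ f0))
    (hw : ∀ i, 1 ≤ i → 0 < w i ∧ w i < 1)
    {r : ℕ → ℝ≥0} (hx : ∀ i, 1 ≤ i → BoundedRatio Θ p (r i) (x i)) (n : ℕ) :
    IsProbabilityMeasure (prMeasure μ Θ p w f0 x n) := by
  induction n with
  | zero => exact h0
  | succ n ih =>
    have hc : prMeasure μ Θ p w f0 x n Θᶜ = 0 := mixingMeasure_compl hΘ _
    have hn := hx (n + 1) n.succ_pos
    have := isProbabilityMeasure_posterior (hp (x (n + 1)))
      (hn.mixture_ne_zero _ hc (hp _)) (hn.mixture_ne_top (prMeasure μ Θ p w f0 x n) hc)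
    obtain ⟨hw0, hw1⟩ := hw (n + 1) n.succ_pos
    constructor
    rw [prMeasure_succ hp hf0]
    simp only [Measure.add_apply, Measure.smul_apply, measure_univ, smul_eq_mul, mul_one]
    rw [← ENNReal.ofReal_add (by linarith) hw0.le]
    simp

theorem mixture_prMeasure_succ (hp : ∀ y, Measurable fun θ => p θ y) (hf0 : Measurable f0)
    (n : ℕ) (y : χ) : mixture p (prMeasure μ Θ p w f0 x (n + 1)) y =
      ENNReal.ofReal (1 - w (n + 1)) * mixture p (prMeasure μ Θ p w f0 x n) y
      + ENNReal.ofReal (w (n + 1))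
        * mixture p (posterior p (prMeasure μ Θ p w f0 x n) (x (n + 1))) y := by
  rw [prMeasure_succ hp hf0, mixture_add, mixture_smul, mixture_smul]

end Recursion

/-! ### Deterministic bounds along a regular path -/

section PathBound

variable {E χ : Type*} [MeasurableSpace E] {μ : Measure E} {Θ : Set E} {p : E → χ → ℝ≥0}
  {w : ℕ → ℝ} {f0 : E → ℝ≥0∞} {x : ℕ → χ}

/-- Because `log (1 + u) ≥ 1 - 1 / (1 + u) = u - u² / (1 + u)`, and `s` bounds the denominator from
below. -/
theorem exp_sub_le_one_add {u s : ℝ} (hs : 0 < s) (hu : s ≤ 1 + u) {e : ℝ} (he : u ^ 2 / s ≤ e) :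
    Real.exp (u - e) ≤ 1 + u := by
  have hpos : 0 < 1 + u := hs.trans_le hu
  rw [← Real.le_log_iff_exp_le hpos]
  have h1 := Real.one_sub_inv_le_log_of_pos hpos
  have h2 : u ^ 2 / (1 + u) ≤ u ^ 2 / s := by gcongr
  have h3 : 1 - (1 + u)⁻¹ = u - u ^ 2 / (1 + u) := by field_simp; ring
  linarith

/-- The cumulative gain of the recursion along a path is at most the initial Kullback-Leibler
divergence. -/
theorem sum_le_toReal_klDiv (hΘ : MeasurableSet Θ)
    (hp : ∀ y, Measurable fun θ => p θ y) (hf0 : Measurable f0)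
    (h0 : IsProbabilityMeasure (mixingMeasure μ Θ f0))
    (hw : ∀ i, 1 ≤ i → 0 < w i ∧ w i < 1) (hanti : ∀ i, 1 ≤ i → w i ≤ w 1)
    {r : ℕ → ℝ≥0} (hx : ∀ i, 1 ≤ i → BoundedRatio Θ p (r i) (x i))
    (F : Measure E) [IsProbabilityMeasure F] (hF : F Θᶜ = 0)
    (hkl : InformationTheory.klDiv F (mixingMeasure μ Θ f0) ≠ ∞) (n : ℕ) :
    ∑ i ∈ Finset.range n,
      (w (i + 1) * ((mixture p F (x (i + 1))
          / mixture p (prMeasure μ Θ p w f0 x i) (x (i + 1))).toReal - 1)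
        - w (i + 1) ^ 2 * (1 + r (i + 1)) ^ 2 / (1 - w 1))
      ≤ (InformationTheory.klDiv F (mixingMeasure μ Θ f0)).toReal := by
  set M : ℕ → ℝ≥0∞ := fun i => mixture p (prMeasure μ Θ p w f0 x i) (x (i + 1)) with hM
  have hprob := isProbabilityMeasure_prMeasure hΘ hp hf0 h0 hw hx
  have hcompl : ∀ i, prMeasure μ Θ p w f0 x i Θᶜ = 0 := fun i => mixingMeasure_compl hΘ _
  have hM0 : ∀ i, M i ≠ 0 := fun i =>
    have := hprob i; (hx (i + 1) i.succ_pos).mixture_ne_zero _ (hcompl i) (hp _)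
  have hρle : ∀ i, ∀ θ ∈ Θ, (p θ (x (i + 1)) : ℝ≥0∞) / M i ≤ r (i + 1) := fun i θ hθ =>
    have := hprob i
    ENNReal.div_le_of_le_mul ((hx (i + 1) i.succ_pos).le_mul_mixture _ (hcompl i) (hp _) hθ)
  have hρm : ∀ i, Measurable fun θ => (p θ (x (i + 1)) : ℝ≥0∞) / M i := fun i =>
    (hp _).coe_nnreal_ennreal.div_const _
  have hρint : ∀ i, ∫⁻ θ, (p θ (x (i + 1)) : ℝ≥0∞) / M i ∂F = mixture p F (x (i + 1)) / M i := by
    intro i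
    simp_rw [div_eq_mul_inv]
    rw [lintegral_mul_const _ (hp _).coe_nnreal_ennreal]
    rfl
  have hρtop : ∀ i, ∫⁻ θ, (p θ (x (i + 1)) : ℝ≥0∞) / M i ∂F ≠ ∞ := fun i => by
    rw [hρint]
    exact ENNReal.div_ne_top ((hx (i + 1) i.succ_pos).mixture_ne_top F hF) (hM0 i)
  have hρi : ∀ i, Integrable (fun θ => ((p θ (x (i + 1)) : ℝ≥0∞) / M i).toReal) F := fun i =>
    integrable_toReal_of_lintegral_ne_top (hρm i).aemeasurable (hρtop i)
  have hti : ∀ i, Integrable (fun θ => w (i + 1) * (((p θ (x (i + 1)) : ℝ≥0∞) / M i).toReal - 1)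
        - w (i + 1) ^ 2 * (1 + r (i + 1)) ^ 2 / (1 - w 1)) F := fun i =>
    (((hρi i).sub (integrable_const 1)).const_mul _).sub (integrable_const _)
  -- Gibbs' inequality with `h = dF_n/dF_0` and `g` the second-order lower bound for `log h`.
  have key := integral_le_toReal_klDiv hkl (integrable_finsetSum (Finset.range n) fun i _ => hti i)
    (h := fun θ => ∏ i ∈ Finset.range n, prFactor μ Θ p w f0 x i θ)
    (Finset.measurable_fun_prod _ fun i _ => measurable_prFactor hp i) ?_ ?_
  · refine le_trans (le_of_eq ?_) key
    rw [integral_finsetSum _ fun i _ => hti i]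
    refine Finset.sum_congr rfl fun i _ => ?_
    have h1 : Integrable
        (fun θ => w (i + 1) * (((p θ (x (i + 1)) : ℝ≥0∞) / M i).toReal - 1)) F :=
      ((hρi i).sub (integrable_const 1)).const_mul _
    rw [integral_sub h1 (integrable_const _), integral_const_mul, integral_sub (hρi i) (integrable_const 1),
      integral_toReal (hρm i).aemeasurable (ae_lt_top (hρm i) (hρtop i)), hρint]
    simp [hM]
  · filter_upwards [ae_mem_of_compl_null hF] with θ hθ
    rw [Real.exp_sum, ENNReal.ofReal_prod_of_nonneg fun _ _ => (Real.exp_pos _).le]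
    refine Finset.prod_le_prod' fun i _ => ?_
    obtain ⟨hw0, hw1⟩ := hw (i + 1) i.succ_pos
    have hwle := hanti (i + 1) i.succ_pos
    have hs : 0 < 1 - w 1 := by linarith [(hw 1 le_rfl).2]
    set ρ := ((p θ (x (i + 1)) : ℝ≥0∞) / M i).toReal with hρ
    have hρ0 : 0 ≤ ρ := ENNReal.toReal_nonneg
    have hρr : ρ ≤ r (i + 1) := ENNReal.toReal_mono (by simp) (hρle i θ hθ)
    have hfac : prFactor μ Θ p w f0 x i θ = ENNReal.ofReal (1 + w (i + 1) * (ρ - 1)) := by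
      have : 1 + w (i + 1) * (ρ - 1) = (1 - w (i + 1)) + w (i + 1) * ρ := by ring
      rw [this, ENNReal.ofReal_add (by linarith) (by positivity), ENNReal.ofReal_mul hw0.le, hρ,
        ENNReal.ofReal_toReal (ENNReal.div_ne_top (by simp) (hM0 i))]
      rfl
    rw [hfac]
    -- Here `u = w (i + 1) * (ρ - 1)` and `s = 1 - w 1`; `0 ≤ ρ ≤ r` gives `|ρ - 1| ≤ 1 + r`.
    refine ENNReal.ofReal_le_ofReal (exp_sub_le_one_add hs ?_ ?_)
    · nlinarith [mul_nonneg hw0.le hρ0]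
    · gcongr
      rw [mul_pow]
      gcongr ?_ * ?_
      exact sq_le_sq' (by linarith) (by linarith)
  · have := (hprob n).measure_univ
    rw [prMeasure_eq_withDensity hp hf0, withDensity_apply _ MeasurableSet.univ,
      Measure.restrict_univ] at this
    exact this.le

/-- One step of the recursion lowers the ratio of the mixture densities only slightly. -/
theorem div_mixture_le_succ (hΘ : MeasurableSet Θ)
    (hp : ∀ y, Measurable fun θ => p θ y) (hf0 : Measurable f0)
    (h0 : IsProbabilityMeasure (mixingMeasure μ Θ f0))
    (hw : ∀ i, 1 ≤ i → 0 < w i ∧ w i < 1)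
    {r : ℕ → ℝ≥0} (hx : ∀ i, 1 ≤ i → BoundedRatio Θ p (r i) (x i))
    (F : Measure E) [IsProbabilityMeasure F] (hF : F Θᶜ = 0) {s : ℝ≥0} {y : χ}
    (hy : BoundedRatio Θ p s y) (n : ℕ) :
    (mixture p F y / mixture p (prMeasure μ Θ p w f0 x n) y).toReal ≤
      (mixture p F y / mixture p (prMeasure μ Θ p w f0 x (n + 1)) y).toReal
        + w (n + 1) * s ^ 2 := by
  have hprob := isProbabilityMeasure_prMeasure hΘ hp hf0 h0 hw hx
  have hcompl : ∀ i, prMeasure μ Θ p w f0 x i Θᶜ = 0 := fun i => mixingMeasure_compl hΘ _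
  have hP := hprob n
  have hP' := hprob (n + 1)
  have hn := hx (n + 1) n.succ_pos
  have hpost := isProbabilityMeasure_posterior (hp (x (n + 1)))
    (hn.mixture_ne_zero _ (hcompl n) (hp _)) (hn.mixture_ne_top _ (hcompl n))
  obtain ⟨hw0, hw1⟩ := hw (n + 1) n.succ_pos
  set A := mixture p (prMeasure μ Θ p w f0 x n) y with hA
  set B := mixture p (prMeasure μ Θ p w f0 x (n + 1)) y with hB
  have hAt : A ≠ ∞ := hy.mixture_ne_top _ (hcompl n)
  have hBt : B ≠ ∞ := hy.mixture_ne_top _ (hcompl (n + 1))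
  have hA0 : 0 < A.toReal :=
    ENNReal.toReal_pos (hy.mixture_ne_zero _ (hcompl n) (hp _)) hAt
  have hB0 : 0 < B.toReal :=
    ENNReal.toReal_pos (hy.mixture_ne_zero _ (hcompl (n + 1)) (hp _)) hBt
  have hFA : (mixture p F y).toReal ≤ s * A.toReal := by
    have := hy.mixture_le_mul_mixture F _ hF (hcompl n) (hp y)
    simpa using ENNReal.toReal_mono (ENNReal.mul_ne_top (by simp) hAt) this
  -- The posterior mixture at `y` is at most `s * A`, so one step enlarges the denominator by a
  -- factor of at most `1 + w s`.
  have hBA : B.toReal ≤ A.toReal * (1 + w (n + 1) * s) := by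
    have h1 := hy.mixture_le_mul_mixture (posterior p _ _) _
      (posterior_compl (hcompl n) (x (n + 1)))
      (hcompl n) (hp y)
    have h2 : B ≤ ENNReal.ofReal (1 - w (n + 1)) * A + ENNReal.ofReal (w (n + 1)) * (s * A) := by
      rw [hB, mixture_prMeasure_succ hp hf0]
      gcongr
    have h3 := ENNReal.toReal_mono (by finiteness) h2
    rw [ENNReal.toReal_add (by finiteness) (by finiteness), ENNReal.toReal_mul,
      ENNReal.toReal_mul, ENNReal.toReal_mul, ENNReal.toReal_ofReal (by linarith),
      ENNReal.toReal_ofReal hw0.le, ENNReal.coe_toReal] at h3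
    nlinarith [mul_nonneg hw0.le hA0.le]
  rw [ENNReal.toReal_div, ENNReal.toReal_div]
  set m := (mixture p F y).toReal with hm
  have hm0 : 0 ≤ m := ENNReal.toReal_nonneg
  have hs0 : (0 : ℝ) ≤ s := s.2
  have hmB : m / (A.toReal * (1 + w (n + 1) * s)) ≤ m / B.toReal := by gcongr
  have hq : m / A.toReal ≤ s := (div_le_iff₀ hA0).2 hFA
  have hq0 : 0 ≤ m / A.toReal := by positivity
  have hc : 0 ≤ w (n + 1) * s := by positivity
  -- With `z = m / A ≤ s` and `c = w s`: `z / (1 + c) ≥ z - c z ≥ z - c s`.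
  have hlow : m / A.toReal - w (n + 1) * s ^ 2 ≤ m / (A.toReal * (1 + w (n + 1) * s)) := by
    rw [← div_div, le_div_iff₀ (by positivity)]
    nlinarith [mul_le_mul_of_nonneg_left hq hc,
      mul_nonneg hc (mul_nonneg hw0.le (sq_nonneg (s : ℝ)))]
  linarith

/-- Iterates the one-step bound; as the weights decrease, every loss is at most the first. It serves
to replace the current mixture by one `q` steps behind the observation. -/
theorem div_mixture_le_add (hΘ : MeasurableSet Θ)
    (hp : ∀ y, Measurable fun θ => p θ y) (hf0 : Measurable f0)
    (h0 : IsProbabilityMeasure (mixingMeasure μ Θ f0))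
    (hw : ∀ i, 1 ≤ i → 0 < w i ∧ w i < 1) (hanti : ∀ i j, 1 ≤ i → i ≤ j → w j ≤ w i)
    {r : ℕ → ℝ≥0} (hx : ∀ i, 1 ≤ i → BoundedRatio Θ p (r i) (x i))
    (F : Measure E) [IsProbabilityMeasure F] (hF : F Θᶜ = 0) {s : ℝ≥0} {y : χ}
    (hy : BoundedRatio Θ p s y) (n t : ℕ) :
    (mixture p F y / mixture p (prMeasure μ Θ p w f0 x n) y).toReal ≤
      (mixture p F y / mixture p (prMeasure μ Θ p w f0 x (n + t)) y).toReal
        + t * (w (n + 1) * s ^ 2) := by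
  induction t with
  | zero => simp
  | succ t ih =>
    have h1 := div_mixture_le_succ hΘ hp hf0 h0 hw hx F hF hy (n + t)
    have h2 : w (n + t + 1) * (s : ℝ) ^ 2 ≤ w (n + 1) * s ^ 2 :=
      mul_le_mul_of_nonneg_right (hanti _ _ (by omega) (by omega)) (sq_nonneg _)
    rw [← add_assoc]
    push_cast
    linarith

/-- The cumulative gain along a path, with the mixture densities delayed by `q` steps. -/
theorem sum_delayed_le (hΘ : MeasurableSet Θ)
    (hp : ∀ y, Measurable fun θ => p θ y) (hf0 : Measurable f0)
    (h0 : IsProbabilityMeasure (mixingMeasure μ Θ f0))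
    (hw : ∀ i, 1 ≤ i → 0 < w i ∧ w i < 1) (hanti : ∀ i j, 1 ≤ i → i ≤ j → w j ≤ w i)
    {r : ℕ → ℝ≥0} (hx : ∀ i, 1 ≤ i → BoundedRatio Θ p (r i) (x i))
    (F : Measure E) [IsProbabilityMeasure F] (hF : F Θᶜ = 0)
    (hkl : InformationTheory.klDiv F (mixingMeasure μ Θ f0) ≠ ∞) {q : ℕ} (hq : 1 ≤ q) (n : ℕ) :
    ∑ k ∈ Finset.range n, w (k + 1 + q) * (mixture p F (x (k + 1 + q))
        / mixture p (prMeasure μ Θ p w f0 x (k + 1)) (x (k + 1 + q))).toReal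
      ≤ ∑ k ∈ Finset.range n, w (k + 1 + q)
        + ((InformationTheory.klDiv F (mixingMeasure μ Θ f0)).toReal + q)
        + ∑ i ∈ Finset.range (q + n), w (i + 1) ^ 2 / (1 - w 1) * (1 + r (i + 1)) ^ 2
        + ∑ k ∈ Finset.range n, q * w (k + 1) ^ 2 * (1 + r (k + 1 + q)) ^ 2 := by
  have h1 := sum_le_toReal_klDiv hΘ hp hf0 h0 hw (fun i hi => hanti 1 i le_rfl hi) hx F hF hkl
    (q + n)
  rw [Finset.sum_sub_distrib, Finset.sum_range_add (n := q) (m := n)] at h1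
  -- The first `q` terms are not delayed; each is at least `-w ≥ -1`, whence the constant `q`.
  have h2 : -(q : ℝ) ≤ ∑ i ∈ Finset.range q, w (i + 1) * ((mixture p F (x (i + 1))
          / mixture p (prMeasure μ Θ p w f0 x i) (x (i + 1))).toReal - 1) := by
    have : ∑ i ∈ Finset.range q, (-1 : ℝ) = -(q : ℝ) := by simp
    rw [← this]
    refine Finset.sum_le_sum fun i _ => ?_
    obtain ⟨hw0, hw1⟩ := hw (i + 1) i.succ_pos
    nlinarith [mul_nonneg hw0.le (ENNReal.toReal_nonneg (a := mixture p F (x (i + 1))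
          / mixture p (prMeasure μ Θ p w f0 x i) (x (i + 1))))]
  have h3 : ∑ k ∈ Finset.range n, (w (k + 1 + q) * (mixture p F (x (k + 1 + q))
        / mixture p (prMeasure μ Θ p w f0 x (k + 1)) (x (k + 1 + q))).toReal
        - w (k + 1 + q) - q * w (k + 1) ^ 2 * (1 + r (k + 1 + q)) ^ 2)
      ≤ ∑ k ∈ Finset.range n, w (q + k + 1) * ((mixture p F (x (q + k + 1))
          / mixture p (prMeasure μ Θ p w f0 x (q + k)) (x (q + k + 1))).toReal - 1) := by
    refine Finset.sum_le_sum fun k _ => ?_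
    have hk : k + 1 + q = q + k + 1 := by omega
    rw [hk]
    obtain ⟨hw0, hw1⟩ := hw (q + k + 1) (by omega)
    obtain ⟨hv0, hv1⟩ := hw (k + 1) (by omega)
    have hwv : w (q + k + 1) ≤ w (k + 1) := hanti _ _ (by omega) (by omega)
    -- The observation `q + k + 1` meets the mixture of index `q + k`, which lies `q - 1` steps
    -- after the delayed index `k + 1`.
    have h4 := div_mixture_le_add hΘ hp hf0 h0 hw hanti hx F hF
      (hx (q + k + 1) (by omega)) (k + 1) (q - 1)
    rw [show k + 1 + (q - 1) = q + k by omega] at h4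
    have hv2 : w (k + 1 + 1) ≤ w (k + 1) := hanti _ _ (by omega) (by omega)
    have h5 : ((q - 1 : ℕ) : ℝ) * (w (k + 1 + 1) * (r (q + k + 1) : ℝ) ^ 2)
        ≤ q * (w (k + 1) * (1 + r (q + k + 1) : ℝ) ^ 2) := by
      have : ((q - 1 : ℕ) : ℝ) ≤ q := by exact_mod_cast Nat.sub_le q 1
      have h6 : (r (q + k + 1) : ℝ) ≤ 1 + r (q + k + 1) := by linarith
      have := (hw (k + 1 + 1) (by omega)).1.le
      gcongr
    have h7 := mul_le_mul_of_nonneg_left (h4.trans (add_le_add_right h5 _)) hw0.le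
    have h8 : w (q + k + 1) * (q * (w (k + 1) * (1 + r (q + k + 1) : ℝ) ^ 2))
        ≤ w (k + 1) * (q * (w (k + 1) * (1 + r (q + k + 1) : ℝ) ^ 2)) := by
      gcongr
    linarith
  rw [Finset.sum_sub_distrib, Finset.sum_sub_distrib] at h3
  have h9 : ∀ i, w (i + 1) ^ 2 * (1 + r (i + 1) : ℝ) ^ 2 / (1 - w 1)
      = w (i + 1) ^ 2 / (1 - w 1) * (1 + r (i + 1) : ℝ) ^ 2 := fun i => by ring
  simp only [h9] at h1
  linarith

end PathBound

/-! ### A square-integrable bound for the likelihood ratios -/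

section RatioBound

theorem add_sq_le_four_mul_ennreal (a b : ℝ≥0∞) : (a + b) ^ 2 ≤ 4 * (a ^ 2 + b ^ 2) := by
  rcases le_total a b with h | h
  · calc (a + b) ^ 2 ≤ (b + b) ^ 2 := by gcongr
      _ = 4 * b ^ 2 := by ring
      _ ≤ _ := by gcongr; exact le_add_self
  · calc (a + b) ^ 2 ≤ (a + a) ^ 2 := by gcongr
      _ = 4 * a ^ 2 := by ring
      _ ≤ _ := by gcongr; exact le_self_add

variable {χ : Type*} [MeasurableSpace χ]

theorem lintegral_add_sq_lt_top {Q : Measure χ} {f g : χ → ℝ≥0∞} (hf : Measurable f)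
    (hf2 : ∫⁻ y, f y ^ 2 ∂Q < ∞) (hg2 : ∫⁻ y, g y ^ 2 ∂Q < ∞) :
    ∫⁻ y, (f y + g y) ^ 2 ∂Q < ∞ := by
  calc ∫⁻ y, (f y + g y) ^ 2 ∂Q ≤ ∫⁻ y, 4 * (f y ^ 2 + g y ^ 2) ∂Q :=
        lintegral_mono fun y => add_sq_le_four_mul_ennreal _ _
    _ = 4 * (∫⁻ y, f y ^ 2 ∂Q + ∫⁻ y, g y ^ 2 ∂Q) := by
        rw [lintegral_const_mul' _ _ (by simp), lintegral_add_left (hf.pow_const 2)]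
    _ < ∞ := by finiteness

theorem lintegral_finset_sum_sq_lt_top {ι : Type*} {Q : Measure χ} {f : ι → χ → ℝ≥0∞}
    (s : Finset ι) (hf : ∀ i ∈ s, Measurable (f i)) (hf2 : ∀ i ∈ s, ∫⁻ y, f i y ^ 2 ∂Q < ∞) :
    ∫⁻ y, (∑ i ∈ s, f i y) ^ 2 ∂Q < ∞ := by
  classical
  induction s using Finset.induction_on with
  | empty => simp
  | insert i s hi ih =>
    simp only [Finset.sum_insert hi]
    exact lintegral_add_sq_lt_top (hf i (Finset.mem_insert_self i s))
      (hf2 i (Finset.mem_insert_self i s))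
      (ih (fun j hj => hf j (Finset.mem_insert_of_mem hj))
        fun j hj => hf2 j (Finset.mem_insert_of_mem hj))

variable {E : Type*} [MeasurableSpace E]

/-- Likelihood ratios over `Θ` are dominated by a function with finite second moment. -/
theorem exists_ratio_bound {ν : Measure χ} [SFinite ν] {Θ : Set E} {ΘH : Finset E} {χc : Set χ}
    {p : E → χ → ℝ≥0} (hp : Measurable (Function.uncurry p)) {q : ℕ} (hq : 1 ≤ q)
    (hA4 : RatioMoments ν Θ ΘH p q) (hC1 : RatioDomination Θ ΘH χc p)
    (hC2 : ∃ a : ℝ≥0, 0 < a ∧ ∀ x ∈ χc, ∀ θ ∈ Θ, a ≤ p θ x)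
    (hC3 : ∃ b : ℝ≥0, ∀ x ∈ χc, ∀ θ ∈ Θ, p θ x ≤ b)
    (F : Measure E) [IsProbabilityMeasure F] (hF : F Θᶜ = 0)
    [IsProbabilityMeasure (ν.withDensity (mixture p F))] :
    ∃ R : χ → ℝ≥0∞, Measurable R ∧ ∫⁻ y, (1 + R y) ^ 2 ∂(ν.withDensity (mixture p F)) < ∞ ∧
      ∀ y, R y ≠ ∞ → mixture p F y ≠ 0 → BoundedRatio Θ p (R y).toNNReal y := by
  obtain ⟨B, -, hB⟩ := hA4
  obtain ⟨cu, -, hcu⟩ := hC1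
  obtain ⟨a, ha, hpa⟩ := hC2
  obtain ⟨b, hpb⟩ := hC3
  have hpθ : ∀ θ, Measurable fun y => (p θ y : ℝ≥0∞) := fun θ =>
    (hp.comp measurable_prodMk_left).coe_nnreal_ennreal
  -- Summing over all pairs of reference points dominates the pair that depends on `y` without a
  -- measurable selection.
  set S : χ → ℝ≥0∞ := fun y =>
    ∑ i ∈ ΘH ×ˢ ΘH, cu * ((p i.2 y : ℝ≥0∞) / (p i.1 y : ℝ≥0∞)) with hS
  have hSi : ∀ i : E × E, Measurable fun y => cu * ((p i.2 y : ℝ≥0∞) / (p i.1 y : ℝ≥0∞)) :=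
    fun i => ((hpθ i.2).div (hpθ i.1)).const_mul _
  have hSm : Measurable S := Finset.measurable_fun_sum _ fun i _ => hSi i
  -- The first term bounds the ratios on `χc`, the second off it; adding them keeps `R` measurable
  -- without a case split.
  refine ⟨fun y => (b / a : ℝ≥0) + S y, hSm.const_add _, ?_, ?_⟩
  · refine lintegral_add_sq_lt_top measurable_const (by simp) ?_
    refine lintegral_add_sq_lt_top measurable_const (by simp) ?_
    refine lintegral_finset_sum_sq_lt_top _ (fun i _ => hSi i) fun i hi => ?_
    rw [Finset.mem_product] at hi
    simp only [mul_pow]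
    have hm2 : Measurable fun y => ((p i.2 y : ℝ≥0∞) / (p i.1 y : ℝ≥0∞)) ^ 2 :=
      ((hpθ i.2).div (hpθ i.1)).pow_const 2
    rw [lintegral_const_mul _ hm2]
    refine ENNReal.mul_lt_top (by finiteness) ?_
    have h1 : ∫⁻ y, ((p i.2 y : ℝ≥0∞) / (p i.1 y : ℝ≥0∞)) ^ 2 ∂(ν.withDensity (mixture p F))
        = ∫⁻ y, ((p i.2 y : ℝ≥0∞) / (p i.1 y : ℝ≥0∞)) ^ 2 * mixture p F y ∂ν := by
      rw [lintegral_withDensity_eq_lintegral_mul _ (measurable_mixture hp F) hm2]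
      exact lintegral_congr fun y => mul_comm _ _
    rw [h1, lintegral_mul_mixture hp F ν hm2]
    -- The moment bound at `k = 2`, admissible since `2 ≤ 4 * q`.
    calc _ ≤ ∫⁻ _, (B : ℝ≥0∞) ∂F :=
          lintegral_mono_ae ((ae_mem_of_compl_null hF).mono fun θ hθ =>
            (hB 2 (by omega) _ (Or.inr hi.2) _ (Or.inr hi.1) θ hθ).le)
      _ < ∞ := by simp
  · intro y hy hm
    have hratio : ∀ θ ∈ Θ, ∀ θ' ∈ Θ, (p θ y : ℝ≥0∞) / p θ' y ≤ (b / a : ℝ≥0) + S y := by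
      intro θ hθ θ' hθ'
      by_cases hyc : y ∈ χc
      · refine le_add_right ?_
        rw [ENNReal.coe_div ha.ne']
        exact ENNReal.div_le_div (by exact_mod_cast hpb y hyc θ hθ)
          (by exact_mod_cast hpa y hyc θ' hθ')
      · obtain ⟨θ₁, h1, θ₂, h2, h12⟩ := hcu y hyc
        refine le_add_left ((h12 θ hθ θ' hθ').trans ?_)
        exact Finset.single_le_sum
          (f := fun i : E × E => cu * ((p i.2 y : ℝ≥0∞) / (p i.1 y : ℝ≥0∞)))
          (fun _ _ => zero_le) (Finset.mk_mem_product h1 h2)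
    obtain ⟨θ₀, hθ₀, hpos⟩ : ∃ θ ∈ Θ, p θ y ≠ 0 := by
      by_contra! hcon
      refine hm ?_
      rw [mixture, lintegral_congr_ae ((ae_mem_of_compl_null hF).mono fun θ hθ => by
        rw [hcon θ hθ])]
      simp
    -- A zero of the kernel at some `θ` would give the ratio `p θ₀ y / 0 = ∞`, against `R y ≠ ∞`.
    have hpos' : ∀ θ ∈ Θ, 0 < p θ y := by
      intro θ hθ
      rw [pos_iff_ne_zero]
      intro h0
      have := hratio θ₀ hθ₀ θ hθ
      rw [h0, ENNReal.coe_zero, ENNReal.div_zero (by simpa using hpos)] at this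
      exact hy (top_le_iff.1 this)
    refine ⟨hpos', fun θ hθ θ' hθ' => ?_⟩
    have := hratio θ hθ θ' hθ'
    rw [ENNReal.div_le_iff (by simpa using (hpos' θ' hθ').ne') (by simp)] at this
    rw [← ENNReal.coe_le_coe, ENNReal.coe_mul, ENNReal.coe_toNNReal hy]
    exact this

end RatioBound

/-! ### Chi-square against total variation; total variation under convex combination -/

section ChiSquare

/-- From `t⁻¹ + t - 2 = (1 - t)² / t ≥ ((1 - t)⁺)² ≥ 2δ(1 - t)⁺ - δ²`. Being linear in the truncated
difference, it integrates directly and takes the place of Cauchy-Schwarz. -/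
theorem two_add_le_inv_add {t δ : ℝ≥0∞} (hδ : δ ≠ ∞) :
    2 + 2 * δ * (1 - t) ≤ t⁻¹ + t + δ ^ 2 := by
  rcases eq_or_ne t 0 with rfl | h0
  · simp
  rcases eq_or_ne t ∞ with rfl | ht
  · simp
  lift t to ℝ≥0 using ht
  lift δ to ℝ≥0 using hδ
  have h0' : t ≠ 0 := by simpa using h0
  have hpos : (0 : ℝ) < t := by exact_mod_cast pos_iff_ne_zero.2 h0'
  rw [← ENNReal.coe_inv h0']
  norm_cast
  rw [← NNReal.coe_le_coe]
  have hδ0 : (0 : ℝ) ≤ δ := δ.2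
  have h2 : (2 : ℝ) + (1 - t) ^ 2 / t = (t : ℝ)⁻¹ + t := by field_simp; ring
  rcases le_total t 1 with h | h
  · have h1 : (t : ℝ) ≤ 1 := by exact_mod_cast h
    push_cast [NNReal.coe_sub h]
    have h3 : (1 - t : ℝ) ^ 2 ≤ (1 - t) ^ 2 / t := by
      rw [le_div_iff₀ hpos]
      exact mul_le_of_le_one_right (sq_nonneg _) h1
    nlinarith [sq_nonneg ((1 - t : ℝ) - δ)]
  · rw [tsub_eq_zero_of_le h]
    push_cast
    have h3 : 0 ≤ (1 - t : ℝ) ^ 2 / t := by positivity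
    nlinarith [sq_nonneg (δ : ℝ)]

variable {χ : Type*} [MeasurableSpace χ]

/-- The chi-square divergence dominates the square of the total variation distance. -/
theorem one_add_sq_le_lintegral_div {ν : Measure χ} {m g : χ → ℝ≥0∞} (hm : Measurable m)
    (hg : Measurable g) (hm1 : ∫⁻ y, m y ∂ν = 1) (hg1 : ∫⁻ y, g y ∂ν ≤ 1) :
    1 + (∫⁻ y, (m y - g y) ∂ν) ^ 2 ≤ ∫⁻ y, m y / g y ∂(ν.withDensity m) := by
  set δ := ∫⁻ y, (m y - g y) ∂ν with hδ
  have hδ1 : δ ≤ 1 := hm1 ▸ lintegral_mono fun y => tsub_le_self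
  have hδt : δ ≠ ∞ := (hδ1.trans_lt ENNReal.one_lt_top).ne
  have hmt : ∀ᵐ y ∂ν, m y < ∞ := ae_lt_top hm (by simp [hm1])
  have hr : Measurable fun y => g y / m y := hg.div hm
  have hQ1 : ν.withDensity m Set.univ = 1 := by simp [hm1]
  have e1 : ∫⁻ y, (1 - g y / m y) ∂(ν.withDensity m) = δ := by
    rw [lintegral_withDensity_eq_lintegral_mul _ hm (hr.const_sub 1)]
    refine lintegral_congr_ae (hmt.mono fun y hy => ?_)
    change m y * (1 - g y / m y) = m y - g y
    rcases eq_or_ne (m y) 0 with h0 | h0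
    · simp [h0]
    · rw [ENNReal.mul_sub fun _ _ => hy.ne, mul_one, ENNReal.mul_div_cancel h0 hy.ne]
  have e2 : ∫⁻ y, g y / m y ∂(ν.withDensity m) ≤ 1 := by
    rw [lintegral_withDensity_eq_lintegral_mul _ hm hr]
    exact (lintegral_mono fun y => ENNReal.mul_div_le).trans hg1
  -- Taken at `t = g / m`, where `m ≠ 0` almost everywhere under `m dν`; `δ` is itself the integral
  -- of `(1 - t)⁺`.
  have hae : ∀ᵐ y ∂(ν.withDensity m), 2 + 2 * δ * (1 - g y / m y)
      ≤ m y / g y + g y / m y + δ ^ 2 := by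
    rw [ae_withDensity_iff hm]
    filter_upwards [hmt] with y hy h0
    have : m y / g y = (g y / m y)⁻¹ := (ENNReal.inv_div (Or.inl hy.ne) (Or.inl h0)).symm
    rw [this]
    exact two_add_le_inv_add hδt
  have key := lintegral_mono_ae hae
  have hl : ∫⁻ y, (2 + 2 * δ * (1 - g y / m y)) ∂(ν.withDensity m) = 2 + 2 * δ * δ := by
    rw [lintegral_add_left measurable_const, lintegral_const_mul _ (hr.const_sub 1), e1,
      lintegral_const, hQ1, mul_one]
  have hrr : ∫⁻ y, (m y / g y + g y / m y + δ ^ 2) ∂(ν.withDensity m)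
      = ∫⁻ y, m y / g y ∂(ν.withDensity m) + ∫⁻ y, g y / m y ∂(ν.withDensity m) + δ ^ 2 := by
    rw [lintegral_add_right _ measurable_const, lintegral_add_right _ hr, lintegral_const, hQ1,
      mul_one]
  rw [hl, hrr] at key
  have h3 : (1 + δ ^ 2) + (1 + δ ^ 2) ≤ ∫⁻ y, m y / g y ∂(ν.withDensity m) + (1 + δ ^ 2) :=
    calc (1 + δ ^ 2) + (1 + δ ^ 2) = 2 + 2 * δ * δ := by ring
      _ ≤ _ := key
      _ ≤ ∫⁻ y, m y / g y ∂(ν.withDensity m) + 1 + δ ^ 2 := by gcongr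
      _ = _ := by ring
  exact (ENNReal.add_le_add_iff_right (by finiteness)).1 h3

/-- Splitting `A = c A + d A` shows that passing to the combination loses at most `d A`; in the
other direction `c A ≤ A` loses at most `d M`. Both have integral at most `d`. -/
theorem lintegral_tsub_le_add {ν : Measure χ} {m A M : χ → ℝ≥0∞} (hA : Measurable A)
    (hM : Measurable M) (hA1 : ∫⁻ y, A y ∂ν ≤ 1) (hM1 : ∫⁻ y, M y ∂ν ≤ 1) {c d : ℝ≥0∞}
    (hcd : c + d = 1) :
    ∫⁻ y, (m y - (c * A y + d * M y)) ∂ν ≤ ∫⁻ y, (m y - A y) ∂ν + d ∧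
      ∫⁻ y, (m y - A y) ∂ν ≤ ∫⁻ y, (m y - (c * A y + d * M y)) ∂ν + d := by
  have hc1 : c ≤ 1 := hcd ▸ le_self_add
  constructor
  · calc _ ≤ ∫⁻ y, ((m y - A y) + d * A y) ∂ν := lintegral_mono fun y => by
          rw [tsub_le_iff_right]
          calc m y ≤ (m y - A y) + (c + d) * A y := by rw [hcd, one_mul]; exact le_tsub_add
            _ ≤ (m y - A y) + (c + d) * A y + d * M y := le_self_add
            _ = _ := by ring
      _ = ∫⁻ y, (m y - A y) ∂ν + d * ∫⁻ y, A y ∂ν := by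
          rw [lintegral_add_right _ (hA.const_mul d), lintegral_const_mul _ hA]
      _ ≤ _ := by gcongr; exact mul_le_of_le_one_right' hA1
  · calc _ ≤ ∫⁻ y, ((m y - (c * A y + d * M y)) + d * M y) ∂ν := lintegral_mono fun y => by
          rw [tsub_le_iff_right]
          calc m y ≤ (m y - (c * A y + d * M y)) + (c * A y + d * M y) := le_tsub_add
            _ ≤ (m y - (c * A y + d * M y)) + (A y + d * M y) := by
              gcongr; exact mul_le_of_le_one_left' hc1
            _ = _ := by ring
      _ = ∫⁻ y, (m y - (c * A y + d * M y)) ∂ν + d * ∫⁻ y, M y ∂ν := by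
          rw [lintegral_add_right _ (hM.const_mul d), lintegral_const_mul _ hM]
      _ ≤ _ := by gcongr; exact mul_le_of_le_one_right' hM1

end ChiSquare

/-! ### Integrating out an independent observation -/

section Independence

variable {Ω χ : Type*} [MeasurableSpace Ω] [MeasurableSpace χ] {P : Measure Ω}
  [IsProbabilityMeasure P] {X : ℕ → Ω → χ}

/-- Integrating out an observation that is independent of the past. -/
theorem IsMDependent.lintegral_eq {q : ℕ} (hq : 1 ≤ q) (hdep : IsMDependent X (q - 1) P)
    (hX : ∀ i, Measurable (X i)) {k : ℕ} (hk : 1 ≤ k) {Φ : (ℕ → χ) × χ → ℝ≥0∞}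
    (hΦ : Measurable Φ)
    (hcongr : ∀ x x' : ℕ → χ, (∀ i, 1 ≤ i → i ≤ k → x i = x' i) → ∀ y, Φ (x, y) = Φ (x', y)) :
    ∫⁻ ω, Φ (fun i => X i ω, X (k + q) ω) ∂P
      = ∫⁻ ω, ∫⁻ y, Φ (fun i => X i ω, y) ∂(P.map (X (k + q))) ∂P := by
  -- Clamping the index to `[1, k]` gives a whole path that is measurable with respect to the past
  -- and agrees with `X` wherever `Φ` looks.
  set Y : Ω → ℕ → χ := fun ω i => X (max 1 (min i k)) ω with hY
  have hYm : Measurable Y := measurable_pi_lambda _ fun i => hX _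
  have hind : IndepFun Y (X (k + q)) P := by
    rw [IndepFun_iff_Indep]
    refine indep_of_indep_of_le_left (indep_of_indep_of_le_right (hdep k hk) ?_) ?_
    · exact le_iSup (fun j : {j : ℕ // k + (q - 1) < j} =>
        MeasurableSpace.comap (X j) inferInstance) ⟨k + q, by omega⟩
    · rw [MeasurableSpace.pi, MeasurableSpace.comap_iSup]
      refine iSup_le fun i => ?_
      rw [MeasurableSpace.comap_comp]
      exact le_iSup (fun j : {j : ℕ // 1 ≤ j ∧ j ≤ k} =>
        MeasurableSpace.comap (X j) inferInstance) ⟨max 1 (min i k), by omega, by omega⟩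
  have hYX : ∀ ω y, Φ (fun i => X i ω, y) = Φ (Y ω, y) := fun ω y =>
    hcongr _ _ (fun i h1 h2 => by simp only [hY, min_eq_left h2, max_eq_right h1]) y
  simp only [hYX]
  have hmap := (indepFun_iff_map_prod_eq_prod_map_map hYm.aemeasurable
    (hX (k + q)).aemeasurable).1 hind
  have : IsProbabilityMeasure (P.map (X (k + q))) :=
    Measure.isProbabilityMeasure_map (hX _).aemeasurable
  rw [← lintegral_map (g := fun ω => (Y ω, X (k + q) ω)) hΦ (hYm.prodMk (hX _)), hmap,
    lintegral_prod _ hΦ.aemeasurable, lintegral_map hΦ.lintegral_prod_right' hYm]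

end Independence

/-! ### Joint measurability of the recursion in the path and the parameter -/

section JointMeasurability

variable {E χ : Type*} [MeasurableSpace E] {μ : Measure E}
  {Θ : Set E} {p : E → χ → ℝ≥0} {w : ℕ → ℝ} {f0 : E → ℝ≥0∞}

theorem mixture_mixingMeasure (hp : ∀ y, Measurable fun θ => p θ y) {f : E → ℝ≥0∞}
    (hf : Measurable f) (y : χ) :
    mixture p (mixingMeasure μ Θ f) y = ∫⁻ θ in Θ, f θ * p θ y ∂μ :=
  lintegral_withDensity_eq_lintegral_mul _ hf (hp y).coe_nnreal_ennreal

theorem measurable_mixture_of_measurable_prDensity [MeasurableSpace χ] [SFinite μ]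
    (hp : Measurable (Function.uncurry p))
    (hf0 : Measurable f0) {n : ℕ}
    (h : Measurable fun z : (ℕ → χ) × E => prDensity μ Θ p w f0 z.1 n z.2) :
    Measurable fun z : (ℕ → χ) × χ => mixture p (prMeasure μ Θ p w f0 z.1 n) z.2 := by
  have hp' : ∀ y, Measurable fun θ => p θ y := fun y => hp.comp measurable_prodMk_right
  simp only [prMeasure, mixture_mixingMeasure hp' (measurable_prDensity hp' hf0 n)]
  exact Measurable.lintegral_prod_right'
    (f := fun z : ((ℕ → χ) × χ) × E => prDensity μ Θ p w f0 z.1.1 n z.2 * (p z.2 z.1.2 : ℝ≥0∞))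
    ((h.comp (measurable_fst.fst.prodMk measurable_snd)).mul
      (hp.comp (measurable_snd.prodMk measurable_fst.snd)).coe_nnreal_ennreal)

theorem measurable_prDensity_uncurry [MeasurableSpace χ] [SFinite μ]
    (hp : Measurable (Function.uncurry p))
    (hf0 : Measurable f0) (n : ℕ) :
    Measurable fun z : (ℕ → χ) × E => prDensity μ Θ p w f0 z.1 n z.2 := by
  induction n with
  | zero => exact hf0.comp measurable_snd
  | succ n ih =>
    have hx : Measurable fun z : (ℕ → χ) × E => z.1 (n + 1) :=
      (measurable_pi_apply (n + 1)).comp measurable_fst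
    have h1 := measurable_mixture_of_measurable_prDensity hp hf0 ih
    exact (ih.const_mul _).add ((((hp.comp (measurable_snd.prodMk hx)).coe_nnreal_ennreal.mul
      ih).div (h1.comp (measurable_fst.prodMk hx))).const_mul _)

theorem measurable_mixture_prMeasure [MeasurableSpace χ] [SFinite μ]
    (hp : Measurable (Function.uncurry p))
    (hf0 : Measurable f0) (n : ℕ) :
    Measurable fun z : (ℕ → χ) × χ => mixture p (prMeasure μ Θ p w f0 z.1 n) z.2 :=
  measurable_mixture_of_measurable_prDensity hp hf0 (measurable_prDensity_uncurry hp hf0 n)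

end JointMeasurability

/-! ### Expected and almost sure decay of the total variation distance -/

section Consistency

variable {E χ : Type*} [MeasurableSpace E] [MeasurableSpace χ] {μ : Measure E} {Θ : Set E}
  {p : E → χ → ℝ≥0} {w : ℕ → ℝ} {f0 : E → ℝ≥0∞} {ν : Measure χ}

/-- The total variation distance between the mixture density of `F` and the one after `n` steps of
the predictive recursion. -/
noncomputable def prDist (ν : Measure χ) (μ : Measure E) (Θ : Set E) (p : E → χ → ℝ≥0)
    (w : ℕ → ℝ) (f0 : E → ℝ≥0∞) (F : Measure E) (x : ℕ → χ) (n : ℕ) : ℝ≥0∞ :=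
  ∫⁻ y, (mixture p F y - mixture p (prMeasure μ Θ p w f0 x n) y) ∂ν

theorem prDist_succ [SFinite ν] (hΘ : MeasurableSet Θ) (hp : Measurable (Function.uncurry p))
    (h1 : ∀ θ ∈ Θ, ∫⁻ x, (p θ x : ℝ≥0∞) ∂ν = 1) (hf0 : Measurable f0)
    (h0 : IsProbabilityMeasure (mixingMeasure μ Θ f0))
    (hw : ∀ i, 1 ≤ i → 0 < w i ∧ w i < 1) {x : ℕ → χ}
    {r : ℕ → ℝ≥0} (hx : ∀ i, 1 ≤ i → BoundedRatio Θ p (r i) (x i)) (F : Measure E) (n : ℕ) :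
    prDist ν μ Θ p w f0 F x (n + 1) ≤ prDist ν μ Θ p w f0 F x n + ENNReal.ofReal (w (n + 1)) ∧
    prDist ν μ Θ p w f0 F x n
      ≤ prDist ν μ Θ p w f0 F x (n + 1) + ENNReal.ofReal (w (n + 1)) := by
  have hp' : ∀ y, Measurable fun θ => p θ y := fun y => hp.comp measurable_prodMk_right
  have hc : prMeasure μ Θ p w f0 x n Θᶜ = 0 := mixingMeasure_compl hΘ _
  have hprob := isProbabilityMeasure_prMeasure hΘ hp' hf0 h0 hw hx n
  have hn := hx (n + 1) n.succ_pos
  have hpost := isProbabilityMeasure_posterior (hp' (x (n + 1)))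
    (hn.mixture_ne_zero _ hc (hp' _)) (hn.mixture_ne_top (prMeasure μ Θ p w f0 x n) hc)
  obtain ⟨hw0, hw1⟩ := hw (n + 1) n.succ_pos
  simp only [prDist, mixture_prMeasure_succ hp' hf0]
  refine lintegral_tsub_le_add (measurable_mixture hp _) (measurable_mixture hp _)
    (lintegral_mixture hp _ ν hc h1).le
    (lintegral_mixture hp _ ν (posterior_compl hc _) h1).le ?_
  rw [← ENNReal.ofReal_add (by linarith) hw0.le]
  simp

/-- A sum of `t` telescoping series. It allows the delayed weights to be exchanged for the undelayed
ones. -/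
theorem summable_sub_shift {u : ℕ → ℝ} (hu : Antitone u) (h0 : ∀ n, 0 ≤ u n) (t : ℕ) :
    Summable fun n => u n - u (n + t) := by
  have h1 : Summable fun n => u n - u (n + 1) :=
    summable_of_sum_range_le (c := u 0) (fun n => sub_nonneg.2 (hu n.le_succ)) fun n => by
      rw [Finset.sum_range_sub']
      linarith [h0 n]
  induction t with
  | zero => simp [summable_zero]
  | succ t ih =>
    refine (ih.add ((summable_nat_add_iff t).2 h1)).congr fun n => ?_
    rw [show n + (t + 1) = n + t + 1 from rfl]
    ring

/-- Along a regular path, a finite weighted sum of squared distances forces the distances to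
vanish. -/
theorem tendsto_prDist [SFinite ν] (hΘ : MeasurableSet Θ) (hp : Measurable (Function.uncurry p))
    (h1 : ∀ θ ∈ Θ, ∫⁻ x, (p θ x : ℝ≥0∞) ∂ν = 1) (hf0 : Measurable f0)
    (h0 : IsProbabilityMeasure (mixingMeasure μ Θ f0)) {q : ℕ} (hq : 1 ≤ q)
    (hA1 : WeightCondition q w) {x : ℕ → χ}
    {r : ℕ → ℝ≥0} (hx : ∀ i, 1 ≤ i → BoundedRatio Θ p (r i) (x i)) (F : Measure E)
    [IsProbabilityMeasure F] (hF : F Θᶜ = 0)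
    (hsum : ∑' k, ENNReal.ofReal (w (k + 1 + q)) * prDist ν μ Θ p w f0 F x (k + 1) ^ 2 ≠ ∞) :
    Tendsto (prDist ν μ Θ p w f0 F x) atTop (𝓝 0) := by
  obtain ⟨hw, hanti, -, hdiv, hsq⟩ := hA1
  set a := prDist ν μ Θ p w f0 F x with ha
  have hstep := prDist_succ (ν := ν) hΘ hp h1 hf0 h0 hw hx F
  have ha1 : ∀ n, a n ≤ 1 := fun n => by
    rw [← lintegral_mixture hp F ν hF h1]
    exact lintegral_mono fun y => tsub_le_self
  have hat : ∀ n, a n ≠ ∞ := fun n => ((ha1 n).trans_lt ENNReal.one_lt_top).ne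
  have hr1 : ∀ n, (a n).toReal ≤ 1 := fun n => by
    simpa using ENNReal.toReal_mono ENNReal.one_ne_top (ha1 n)
  have hr0 : ∀ n, 0 ≤ (a n).toReal := fun n => ENNReal.toReal_nonneg
  have hwpos : ∀ n, 0 ≤ w (n + 1) := fun n => (hw (n + 1) n.succ_pos).1.le
  have hinc : ∀ n, |(a (n + 1)).toReal - (a n).toReal| ≤ w (n + 1) := fun n => by
    obtain ⟨h2, h3⟩ := hstep n
    have h2' := ENNReal.toReal_mono (by have := hat n; finiteness) h2
    have h3' := ENNReal.toReal_mono (by have := hat (n + 1); finiteness) h3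
    rw [ENNReal.toReal_add (hat _) (by simp), ENNReal.toReal_ofReal (hwpos n)] at h2' h3'
    rw [abs_le]
    constructor <;> linarith
  have hs1 : Summable fun k => w (k + 1 + q) * (a (k + 1)).toReal ^ 2 := by
    refine (ENNReal.summable_toReal hsum).congr fun k => ?_
    rw [ENNReal.toReal_mul, ENNReal.toReal_pow,
      ENNReal.toReal_ofReal (hw (k + 1 + q) (by omega)).1.le]
  -- The sum carries the delayed weight `w (k + 1 + q)`, but the distance of index `k + 1` moves by
  -- `w (k + 2)`; as it is at most one, the exchange costs a summable term.
  have hshift : Summable fun k => w (k + 2) - w (k + 1 + q) := by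
    have := summable_sub_shift (u := fun n => w (n + 2))
      (fun i j hij => hanti _ _ (by omega) (by omega)) (fun n => hwpos (n + 1)) (q - 1)
    refine this.congr fun k => ?_
    rw [show k + (q - 1) + 2 = k + 1 + q by omega]
  have hs2 : Summable fun k => w (k + 2) * (a (k + 1)).toReal ^ 2 := by
    refine Summable.of_nonneg_of_le (fun k => mul_nonneg (hwpos (k + 1)) (sq_nonneg _))
      (fun k => ?_) (hs1.add hshift)
    have h2 : w (k + 1 + q) ≤ w (k + 2) := hanti _ _ (by omega) (by omega)
    have h3 : (a (k + 1)).toReal ^ 2 ≤ 1 := pow_le_one₀ (hr0 _) (hr1 _)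
    nlinarith
  have hb : Tendsto (fun k => (a (k + 1)).toReal ^ 2) atTop (𝓝 0) := by
    -- Applied to the squared distance: on `[0, 1]` squaring is 2-Lipschitz, whence `C = 2`.
    refine tendsto_zero_of_summable_mul (w := fun k => w (k + 2)) (C := 2) (by norm_num)
      (fun k => hwpos (k + 1)) ((summable_nat_add_iff 1).2 hsq) ?_ (fun k => sq_nonneg _) ?_ hs2
    · intro hs
      have hs' : Summable w := (summable_nat_add_iff 2).1 hs
      exact hdiv 1 le_rfl hq (hs'.comp_injective (i := fun i => 1 + (i + 1) * q) fun i j hij => by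
        simpa [show q ≠ 0 by omega] using hij)
    · intro k
      rw [show (a (k + 1 + 1)).toReal ^ 2 - (a (k + 1)).toReal ^ 2
        = ((a (k + 1 + 1)).toReal + (a (k + 1)).toReal)
          * ((a (k + 1 + 1)).toReal - (a (k + 1)).toReal) by ring, abs_mul,
        abs_of_nonneg (add_nonneg (hr0 _) (hr0 _))]
      exact mul_le_mul (by linarith [hr1 (k + 1), hr1 (k + 1 + 1)]) (hinc (k + 1))
        (abs_nonneg _) (by norm_num)
  rw [← tendsto_add_atTop_iff_nat 1, ← ENNReal.tendsto_toReal_iff (fun k => hat (k + 1)) (by simp)]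
  have := (Real.continuous_sqrt.tendsto _).comp hb
  simpa [Function.comp_def, Real.sqrt_sq (hr0 _)] using this

variable {Ω : Type*} [MeasurableSpace Ω] {P : Measure Ω}
  {X : ℕ → Ω → χ}

theorem measurable_prDist [SFinite μ] [SFinite ν] (hp : Measurable (Function.uncurry p))
    (hf0 : Measurable f0) (F : Measure E) [SFinite F] (n : ℕ) :
    Measurable fun x : ℕ → χ => prDist ν μ Θ p w f0 F x n :=
  Measurable.lintegral_prod_right' (f := fun z : (ℕ → χ) × χ =>
      mixture p F z.2 - mixture p (prMeasure μ Θ p w f0 z.1 n) z.2)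
    (((measurable_mixture hp F).comp measurable_snd).sub (measurable_mixture_prMeasure hp hf0 n))

/-- Almost every path is regular. -/
theorem ae_boundedRatio [SFinite ν] (hp : Measurable (Function.uncurry p))
    (hX : ∀ i, Measurable (X i)) {F : Measure E} [IsProbabilityMeasure F]
    (hlaw : ∀ i, 1 ≤ i → P.map (X i) = ν.withDensity (mixture p F))
    {R : χ → ℝ≥0∞} (hR : Measurable R)
    (hR2 : ∫⁻ y, (1 + R y) ^ 2 ∂(ν.withDensity (mixture p F)) < ∞)
    (hbd : ∀ y, R y ≠ ∞ → mixture p F y ≠ 0 → BoundedRatio Θ p (R y).toNNReal y) :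
    ∀ᵐ ω ∂P, ∀ i, 1 ≤ i → R (X i ω) ≠ ∞ ∧ BoundedRatio Θ p (R (X i ω)).toNNReal (X i ω) := by
  have hae : ∀ᵐ y ∂(ν.withDensity (mixture p F)),
      R y ≠ ∞ ∧ BoundedRatio Θ p (R y).toNNReal y := by
    have h1 := ae_lt_top ((hR.const_add 1).pow_const 2) hR2.ne
    have h2 : ∀ᵐ y ∂(ν.withDensity (mixture p F)), mixture p F y ≠ 0 := by
      rw [ae_withDensity_iff (measurable_mixture hp F)]
      exact Eventually.of_forall fun _ h => h
    filter_upwards [h1, h2] with y hy1 hy2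
    have hy : R y ≠ ∞ := by
      intro h
      simp [h] at hy1
    exact ⟨hy, hbd y hy hy2⟩
  rw [ae_all_iff]
  intro i
  rw [ae_all_iff]
  intro hi
  rw [← hlaw i hi] at hae
  exact ae_of_ae_map (hX i).aemeasurable hae

/-- The expected weighted sums of the squared distances are bounded. -/
theorem exists_sum_lintegral_le [IsProbabilityMeasure P] [SFinite μ] [SFinite ν] (hΘ : MeasurableSet Θ)
    (hp : Measurable (Function.uncurry p))
    (h1 : ∀ θ ∈ Θ, ∫⁻ x, (p θ x : ℝ≥0∞) ∂ν = 1) (hf0 : Measurable f0)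
    (h0 : IsProbabilityMeasure (mixingMeasure μ Θ f0)) {q : ℕ} (hq : 1 ≤ q)
    (hA1 : WeightCondition q w) {F : Measure E} [IsProbabilityMeasure F] (hF : F Θᶜ = 0)
    (hkl : InformationTheory.klDiv F (mixingMeasure μ Θ f0) ≠ ∞)
    (hX : ∀ i, Measurable (X i)) (hdep : IsMDependent X (q - 1) P)
    (hlaw : ∀ i, 1 ≤ i → P.map (X i) = ν.withDensity (mixture p F))
    {R : χ → ℝ≥0∞} (hR : Measurable R)
    (hR2 : ∫⁻ y, (1 + R y) ^ 2 ∂(ν.withDensity (mixture p F)) < ∞)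
    (hreg : ∀ᵐ ω ∂P, ∀ i, 1 ≤ i →
      R (X i ω) ≠ ∞ ∧ BoundedRatio Θ p (R (X i ω)).toNNReal (X i ω)) :
    ∃ K : ℝ≥0∞, K ≠ ∞ ∧ ∀ n, ∑ k ∈ Finset.range n, ENNReal.ofReal (w (k + 1 + q)) *
      ∫⁻ ω, prDist ν μ Θ p w f0 F (fun i => X i ω) (k + 1) ^ 2 ∂P ≤ K := by
  obtain ⟨hw, hanti, -, -, hsq⟩ := hA1
  have hp' : ∀ y, Measurable fun θ => p θ y := fun y => hp.comp measurable_prodMk_right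
  have hs : 0 < 1 - w 1 := by linarith [(hw 1 le_rfl).2]
  set D := ∫⁻ y, (1 + R y) ^ 2 ∂(ν.withDensity (mixture p F)) with hD
  have hRm : Measurable fun y => (1 + R y) ^ 2 := (hR.const_add 1).pow_const 2
  have hDi : ∀ i, 1 ≤ i → ∫⁻ ω, (1 + R (X i ω)) ^ 2 ∂P = D := fun i hi => by
    rw [hD, ← hlaw i hi, lintegral_map hRm (hX i)]
  set V := ∑' i, w (i + 1) ^ 2 with hV
  set K0 := (InformationTheory.klDiv F (mixingMeasure μ Θ f0)).toReal + q with hK0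
  have hK0' : 0 ≤ K0 := by positivity
  -- The three terms are the expectations of the error terms in `sum_delayed_le`; all observations
  -- share one law, so each `(1 + R)²` contributes `D`.
  refine ⟨ENNReal.ofReal K0 + ENNReal.ofReal (V / (1 - w 1)) * D + ENNReal.ofReal (q * V) * D,
    by finiteness, fun n => ?_⟩
  set ρ : ℕ → Ω → ℝ≥0∞ := fun k ω => mixture p F (X (k + 1 + q) ω)
    / mixture p (prMeasure μ Θ p w f0 (fun i => X i ω) (k + 1)) (X (k + 1 + q) ω) with hρ
  have hΦm : ∀ k, Measurable fun z : (ℕ → χ) × χ =>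
      mixture p F z.2 / mixture p (prMeasure μ Θ p w f0 z.1 (k + 1)) z.2 := fun k =>
    ((measurable_mixture hp F).comp measurable_snd).div (measurable_mixture_prMeasure hp hf0 _)
  have hXm : Measurable fun ω i => X i ω := measurable_pi_lambda _ hX
  have hρm : ∀ k, Measurable (ρ k) := fun k =>
    (hΦm k).comp (hXm.prodMk (hX (k + 1 + q)))
  have hdm : ∀ k, Measurable fun ω => prDist ν μ Θ p w f0 F (fun i => X i ω) (k + 1) ^ 2 :=
    fun k => ((measurable_prDist hp hf0 F (k + 1)).comp hXm).pow_const 2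
  -- Given the first `k + 1` observations, `X (k + 1 + q)` still has density `m`, so the expected
  -- ratio is a chi-square integral.
  have hlow : ∀ k, 1 + ∫⁻ ω, prDist ν μ Θ p w f0 F (fun i => X i ω) (k + 1) ^ 2 ∂P
      ≤ ∫⁻ ω, ρ k ω ∂P := by
    intro k
    have e1 := hdep.lintegral_eq hq hX (k := k + 1) (by omega) (hΦm k)
      (fun x x' hxx y => by simp only [prMeasure, prDensity_congr hxx])
    rw [show ∫⁻ ω, ρ k ω ∂P = _ from e1, hlaw _ (by omega)]
    have e2 : 1 + ∫⁻ ω, prDist ν μ Θ p w f0 F (fun i => X i ω) (k + 1) ^ 2 ∂P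
        = ∫⁻ ω, (1 + prDist ν μ Θ p w f0 F (fun i => X i ω) (k + 1) ^ 2) ∂P := by
      rw [lintegral_add_left measurable_const]
      simp
    rw [e2]
    refine lintegral_mono_ae (hreg.mono fun ω hω => ?_)
    have := isProbabilityMeasure_prMeasure hΘ hp' hf0 h0 hw (x := fun i => X i ω)
      (r := fun i => (R (X i ω)).toNNReal) (fun i hi => (hω i hi).2) (k + 1)
    exact one_add_sq_le_lintegral_div (measurable_mixture hp F) (measurable_mixture hp _)
      (lintegral_mixture hp F ν hF h1)
      (lintegral_mixture hp (prMeasure μ Θ p w f0 _ _) ν (mixingMeasure_compl hΘ _) h1).le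
  have hpath : ∀ᵐ ω ∂P, ∑ k ∈ Finset.range n, ENNReal.ofReal (w (k + 1 + q)) * ρ k ω
      ≤ ENNReal.ofReal (∑ k ∈ Finset.range n, w (k + 1 + q)) + ENNReal.ofReal K0
        + ∑ i ∈ Finset.range (q + n), ENNReal.ofReal (w (i + 1) ^ 2 / (1 - w 1))
            * (1 + R (X (i + 1) ω)) ^ 2
        + ∑ k ∈ Finset.range n, ENNReal.ofReal (q * w (k + 1) ^ 2)
            * (1 + R (X (k + 1 + q) ω)) ^ 2 := by
    filter_upwards [hreg] with ω hω
    have hx : ∀ i, 1 ≤ i → BoundedRatio Θ p (R (X i ω)).toNNReal (X i ω) :=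
      fun i hi => (hω i hi).2
    have hprob := isProbabilityMeasure_prMeasure hΘ hp' hf0 h0 hw (x := fun i => X i ω)
      (r := fun i => (R (X i ω)).toNNReal) hx
    have hρt : ∀ k, ρ k ω ≠ ∞ := fun k => by
      have := hprob (k + 1)
      exact ENNReal.div_ne_top ((hx _ (by omega)).mixture_ne_top F hF)
        ((hx _ (by omega)).mixture_ne_zero _ (mixingMeasure_compl hΘ _) (hp' _))
    have hRr : ∀ i, 1 ≤ i → (1 + R (X i ω)) ^ 2
        = ENNReal.ofReal ((1 + (R (X i ω)).toNNReal : ℝ) ^ 2) := fun i hi => by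
      rw [ENNReal.ofReal_pow (by positivity), ENNReal.ofReal_add zero_le_one (by positivity),
        ENNReal.ofReal_one, ENNReal.ofReal_coe_nnreal, ENNReal.coe_toNNReal (hω i hi).1]
    have hwk : ∀ k, 0 ≤ w (k + 1 + q) := fun k => (hw _ (by omega)).1.le
    have key := sum_delayed_le hΘ hp' hf0 h0 hw hanti (x := fun i => X i ω)
      (r := fun i => (R (X i ω)).toNNReal) hx F hF hkl hq n
    have el : ∑ k ∈ Finset.range n, ENNReal.ofReal (w (k + 1 + q)) * ρ k ω
        = ENNReal.ofReal (∑ k ∈ Finset.range n, w (k + 1 + q) * (ρ k ω).toReal) := by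
      rw [ENNReal.ofReal_sum_of_nonneg fun k _ => mul_nonneg (hwk k) ENNReal.toReal_nonneg]
      exact Finset.sum_congr rfl fun k _ => by
        rw [ENNReal.ofReal_mul (hwk k), ENNReal.ofReal_toReal (hρt k)]
    rw [el]
    refine (ENNReal.ofReal_le_ofReal key).trans (le_of_eq ?_)
    have n1 : 0 ≤ ∑ k ∈ Finset.range n, w (k + 1 + q) := Finset.sum_nonneg fun k _ => hwk k
    have n2 : ∀ i, 0 ≤ w (i + 1) ^ 2 / (1 - w 1) * (1 + (R (X (i + 1) ω)).toNNReal : ℝ) ^ 2 :=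
      fun i => by positivity
    have n3 : ∀ k, 0 ≤ q * w (k + 1) ^ 2 * (1 + (R (X (k + 1 + q) ω)).toNNReal : ℝ) ^ 2 :=
      fun k => by positivity
    have n2' := Finset.sum_nonneg fun i (_ : i ∈ Finset.range (q + n)) => n2 i
    have n3' := Finset.sum_nonneg fun i (_ : i ∈ Finset.range n) => n3 i
    rw [ENNReal.ofReal_add (by positivity) n3', ENNReal.ofReal_add (by positivity) n2',
      ENNReal.ofReal_add n1 hK0', ENNReal.ofReal_sum_of_nonneg fun i _ => n2 i,
      ENNReal.ofReal_sum_of_nonneg fun i _ => n3 i]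
    congr 1
    · congr 1
      refine Finset.sum_congr rfl fun i _ => ?_
      rw [ENNReal.ofReal_mul (by positivity), hRr (i + 1) (by omega)]
    · refine Finset.sum_congr rfl fun k _ => ?_
      rw [ENNReal.ofReal_mul (by positivity), hRr (k + 1 + q) (by omega)]
  have hint := lintegral_mono_ae hpath
  have hRX : ∀ i, Measurable fun ω => (1 + R (X i ω)) ^ 2 := fun i => hRm.comp (hX i)
  have hL : ∫⁻ ω, ∑ k ∈ Finset.range n, ENNReal.ofReal (w (k + 1 + q)) * ρ k ω ∂P
      = ∑ k ∈ Finset.range n, ENNReal.ofReal (w (k + 1 + q)) * ∫⁻ ω, ρ k ω ∂P := by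
    rw [lintegral_finsetSum _ fun k _ => (hρm k).const_mul _]
    exact Finset.sum_congr rfl fun k _ => lintegral_const_mul _ (hρm k)
  have hT1 : ∫⁻ ω, ∑ i ∈ Finset.range (q + n), ENNReal.ofReal (w (i + 1) ^ 2 / (1 - w 1))
      * (1 + R (X (i + 1) ω)) ^ 2 ∂P ≤ ENNReal.ofReal (V / (1 - w 1)) * D := by
    rw [lintegral_finsetSum _ fun i _ => (hRX _).const_mul _]
    simp_rw [lintegral_const_mul _ (hRX _), hDi _ (Nat.succ_pos _)]
    rw [← Finset.sum_mul, ← ENNReal.ofReal_sum_of_nonneg fun i _ => by positivity,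
      ← Finset.sum_div]
    gcongr
    exact hsq.sum_le_tsum _ fun i _ => sq_nonneg _
  have hT2 : ∫⁻ ω, ∑ k ∈ Finset.range n, ENNReal.ofReal (q * w (k + 1) ^ 2)
      * (1 + R (X (k + 1 + q) ω)) ^ 2 ∂P ≤ ENNReal.ofReal (q * V) * D := by
    rw [lintegral_finsetSum _ fun i _ => (hRX _).const_mul _]
    simp_rw [lintegral_const_mul _ (hRX _)]
    rw [Finset.sum_congr rfl fun k _ => by rw [hDi (k + 1 + q) (by omega)], ← Finset.sum_mul,
      ← ENNReal.ofReal_sum_of_nonneg fun i _ => by positivity, ← Finset.mul_sum]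
    gcongr
    exact hsq.sum_le_tsum _ fun i _ => sq_nonneg _
  rw [hL, lintegral_add_left (by fun_prop), lintegral_add_left (by fun_prop), lintegral_const,
    measure_univ, mul_one] at hint
  have hW : ENNReal.ofReal (∑ k ∈ Finset.range n, w (k + 1 + q))
      = ∑ k ∈ Finset.range n, ENNReal.ofReal (w (k + 1 + q)) :=
    ENNReal.ofReal_sum_of_nonneg fun k _ => (hw _ (by omega)).1.le
  have hfin : ENNReal.ofReal (∑ k ∈ Finset.range n, w (k + 1 + q)) ≠ ∞ := ENNReal.ofReal_ne_top
  -- The `1` in `hlow` produces exactly the sum of the weights in `hpath`; this sum is finite and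
  -- cancels, leaving a bound independent of `n`.
  refine (ENNReal.add_le_add_iff_left hfin).1 ?_
  calc _ = ∑ k ∈ Finset.range n, ENNReal.ofReal (w (k + 1 + q)) *
        (1 + ∫⁻ ω, prDist ν μ Θ p w f0 F (fun i => X i ω) (k + 1) ^ 2 ∂P) := by
        rw [hW, ← Finset.sum_add_distrib]
        exact Finset.sum_congr rfl fun k _ => by ring
    _ ≤ ∑ k ∈ Finset.range n, ENNReal.ofReal (w (k + 1 + q)) * ∫⁻ ω, ρ k ω ∂P := by
        gcongr with k _
        exact hlow k
    _ ≤ _ := hint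
    _ ≤ _ := by
        rw [← add_assoc, ← add_assoc]
        gcongr

/-- Almost surely the mixture densities of the predictive recursion converge in total
variation. -/
theorem ae_tendsto_prDist [IsProbabilityMeasure P] [SFinite μ] [SFinite ν] (hΘ : MeasurableSet Θ)
    (hp : Measurable (Function.uncurry p))
    (h1 : ∀ θ ∈ Θ, ∫⁻ x, (p θ x : ℝ≥0∞) ∂ν = 1) (hf0 : Measurable f0)
    (h0 : IsProbabilityMeasure (mixingMeasure μ Θ f0)) {q : ℕ} (hq : 1 ≤ q)
    (hA1 : WeightCondition q w) {F : Measure E} [IsProbabilityMeasure F] (hF : F Θᶜ = 0)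
    (hkl : InformationTheory.klDiv F (mixingMeasure μ Θ f0) ≠ ∞)
    (hX : ∀ i, Measurable (X i)) (hdep : IsMDependent X (q - 1) P)
    (hlaw : ∀ i, 1 ≤ i → P.map (X i) = ν.withDensity (mixture p F))
    {R : χ → ℝ≥0∞} (hR : Measurable R)
    (hR2 : ∫⁻ y, (1 + R y) ^ 2 ∂(ν.withDensity (mixture p F)) < ∞)
    (hreg : ∀ᵐ ω ∂P, ∀ i, 1 ≤ i →
      R (X i ω) ≠ ∞ ∧ BoundedRatio Θ p (R (X i ω)).toNNReal (X i ω)) :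
    ∀ᵐ ω ∂P, Tendsto (prDist ν μ Θ p w f0 F (fun i => X i ω)) atTop (𝓝 0) := by
  obtain ⟨K, hK, hKn⟩ := exists_sum_lintegral_le hΘ hp h1 hf0 h0 hq hA1 hF hkl hX hdep hlaw hR hR2
    hreg
  have hXm : Measurable fun ω i => X i ω := measurable_pi_lambda _ hX
  have hdm : ∀ k, Measurable fun ω => prDist ν μ Θ p w f0 F (fun i => X i ω) (k + 1) ^ 2 :=
    fun k => ((measurable_prDist hp hf0 F (k + 1)).comp hXm).pow_const 2
  have hm : ∀ k, Measurable fun ω => ENNReal.ofReal (w (k + 1 + q)) *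
      prDist ν μ Θ p w f0 F (fun i => X i ω) (k + 1) ^ 2 := fun k => (hdm k).const_mul _
  -- By Tonelli the series has finite expectation, hence is finite almost surely.
  have hfin : ∫⁻ ω, ∑' k, ENNReal.ofReal (w (k + 1 + q)) *
      prDist ν μ Θ p w f0 F (fun i => X i ω) (k + 1) ^ 2 ∂P ≠ ∞ := by
    rw [lintegral_tsum fun k => (hm k).aemeasurable]
    simp_rw [lintegral_const_mul _ (hdm _)]
    exact ne_top_of_le_ne_top hK (ENNReal.tsum_le_of_sum_range_le hKn)
  filter_upwards [ae_lt_top (Measurable.tsum hm) hfin, hreg] with ω hω hreg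
  exact tendsto_prDist hΘ hp h1 hf0 h0 hq hA1 (r := fun i => (R (X i ω)).toNNReal)
    (fun i hi => (hreg i hi).2) F hF hω.ne

theorem IsMDependent.congr {X' : ℕ → Ω → χ} {M : ℕ} (h : IsMDependent X M P)
    (hXX' : ∀ i, 1 ≤ i → X i = X' i) : IsMDependent X' M P := by
  intro i hi
  have h1 : (fun j : {j : ℕ // 1 ≤ j ∧ j ≤ i} => MeasurableSpace.comap (X' j) inferInstance)
      = fun j : {j : ℕ // 1 ≤ j ∧ j ≤ i} => MeasurableSpace.comap (X j) inferInstance :=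
    funext fun j => by rw [hXX' j j.2.1]
  have h2 : (fun j : {j : ℕ // i + M < j} => MeasurableSpace.comap (X' j) inferInstance)
      = fun j : {j : ℕ // i + M < j} => MeasurableSpace.comap (X j) inferInstance :=
    funext fun j => by rw [hXX' j (by have := j.2; omega)]
  rw [h1, h2]
  exact h i hi

end Consistency

end PredictiveRecursion

/-! ### The theorem -/

theorem mainTheorem3 {d : ℕ} {χ Ω : Type*}
    [TopologicalSpace χ] [MeasurableSpace χ] [BorelSpace χ]
    [MeasurableSpace Ω] (P : Measure Ω) [IsProbabilityMeasure P]
    (ν : Measure χ) [SigmaFinite ν]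
    (μ : Measure (EuclideanSpace ℝ (Fin d))) [SigmaFinite μ]
    -- parameter sets
    (Θ Θhat : Set (EuclideanSpace ℝ (Fin d))) (ΘH : Finset (EuclideanSpace ℝ (Fin d)))
    (hΘ : IsCompact Θ) (hΘhat_closed : IsClosed Θhat) (hΘhat_convex : Convex ℝ Θhat)
    (hΘ_sub : Θ ⊆ Θhat) (hΘH_sub : (ΘH : Set (EuclideanSpace ℝ (Fin d))) ⊆ Θhat)
    -- the kernel: a probability density with respect to `ν` for every parameter
    (p : EuclideanSpace ℝ (Fin d) → χ → ℝ≥0)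
    (hp_meas : Measurable (Function.uncurry p))
    (hp_one : ∀ θ ∈ Θhat, ∫⁻ x, (p θ x : ℝ≥0∞) ∂ν = 1)
    -- the true and the initial mixing densities, at finite Kullback-Leibler divergence
    (f f0 : EuclideanSpace ℝ (Fin d) → ℝ≥0∞) (hf_meas : Measurable f) (hf0_meas : Measurable f0)
    (hf : IsProbabilityMeasure (PredictiveRecursion.mixingMeasure μ Θ f))
    (hf0 : IsProbabilityMeasure (PredictiveRecursion.mixingMeasure μ Θ f0))
    (hK0 : InformationTheory.klDiv (PredictiveRecursion.mixingMeasure μ Θ f)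
      (PredictiveRecursion.mixingMeasure μ Θ f0) ≠ ∞)
    -- the observations
    (q : ℕ) (hq : 1 ≤ q) (X : ℕ → Ω → χ) (hX_meas : ∀ i, 1 ≤ i → Measurable (X i))
    (hX_dep : PredictiveRecursion.IsMDependent X (q - 1) P)
    (hX_law : ∀ i, 1 ≤ i → P.map (X i) =
      ν.withDensity (PredictiveRecursion.mixture p (PredictiveRecursion.mixingMeasure μ Θ f)))
    -- weights, identifiability, continuity, moments
    (w : ℕ → ℝ) (hA1 : PredictiveRecursion.WeightCondition q w)
    (hA2 : PredictiveRecursion.Identifiable ν Θ p)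
    (hA3 : PredictiveRecursion.KernelContinuous Θ p)
    (hA4 : PredictiveRecursion.RatioMoments ν Θ ΘH p q)
    -- domination outside a compact set, two-sided bounds on it
    (χc : Set χ) (hχc : IsCompact χc)
    (hC1 : PredictiveRecursion.RatioDomination Θ ΘH χc p)
    (hC2 : ∃ a : ℝ≥0, 0 < a ∧ ∀ x ∈ χc, ∀ θ ∈ Θ, a ≤ p θ x)
    (hC3 : ∃ b : ℝ≥0, ∀ x ∈ χc, ∀ θ ∈ Θ, p θ x ≤ b) :
    ∀ᵐ ω ∂P, ∃ hn : ∀ n : ℕ, IsProbabilityMeasure (PredictiveRecursion.mixingMeasure μ Θ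
        (PredictiveRecursion.prDensity μ Θ p w f0 (fun i => X i ω) n)),
      Tendsto (β := ProbabilityMeasure (EuclideanSpace ℝ (Fin d)))
        (fun n : ℕ => ⟨PredictiveRecursion.mixingMeasure μ Θ
          (PredictiveRecursion.prDensity μ Θ p w f0 (fun i => X i ω) n), hn n⟩)
        atTop (𝓝 ⟨PredictiveRecursion.mixingMeasure μ Θ f, hf⟩) := by
  have h1 : ∀ θ ∈ Θ, ∫⁻ x, (p θ x : ℝ≥0∞) ∂ν = 1 := fun θ hθ => hp_one θ (hΘ_sub hθ)
  have hp' : ∀ y, Measurable fun θ => p θ y := fun y => hp_meas.comp measurable_prodMk_right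
  have hΘm := hΘ.measurableSet
  have hF := PredictiveRecursion.mixingMeasure_compl (μ := μ) hΘm f
  have hQ : IsProbabilityMeasure (ν.withDensity
      (PredictiveRecursion.mixture p (PredictiveRecursion.mixingMeasure μ Θ f))) := by
    rw [← hX_law 1 le_rfl]
    exact Measure.isProbabilityMeasure_map (hX_meas 1 le_rfl).aemeasurable
  obtain ⟨R, hR, hR2, hbd⟩ := PredictiveRecursion.exists_ratio_bound hp_meas hq hA4 hC1 hC2 hC3
    (PredictiveRecursion.mixingMeasure μ Θ f) hF
  -- `X 0` need not be measurable. The recursion never reads it, so it is replaced by `X 1` to make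
  -- the whole path measurable.
  let X' : ℕ → Ω → χ := fun i => X (max i 1)
  have hXX' : ∀ i, 1 ≤ i → X i = X' i := fun i hi => by simp only [X', max_eq_left hi]
  have hX'm : ∀ i, Measurable (X' i) := fun i => hX_meas _ (le_max_right i 1)
  have hlaw : ∀ i, 1 ≤ i → P.map (X' i) = ν.withDensity
      (PredictiveRecursion.mixture p (PredictiveRecursion.mixingMeasure μ Θ f)) :=
    fun i hi => hXX' i hi ▸ hX_law i hi
  have hreg := PredictiveRecursion.ae_boundedRatio hp_meas hX'm hlaw hR hR2 hbd
  filter_upwards [hreg, PredictiveRecursion.ae_tendsto_prDist hΘm hp_meas h1 hf0_meas hf0 hq hA1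
    hF hK0 hX'm (hX_dep.congr hXX') hlaw hR hR2 hreg] with ω hω hlim
  have hden : ∀ n, PredictiveRecursion.prDensity μ Θ p w f0 (fun i => X i ω) n
      = PredictiveRecursion.prDensity μ Θ p w f0 (fun i => X' i ω) n := fun n =>
    PredictiveRecursion.prDensity_congr fun i hi _ => by rw [hXX' i hi]
  have hn : ∀ n, IsProbabilityMeasure (PredictiveRecursion.mixingMeasure μ Θ
      (PredictiveRecursion.prDensity μ Θ p w f0 (fun i => X i ω) n)) := fun n => by
    rw [hden]
    exact PredictiveRecursion.isProbabilityMeasure_prMeasure hΘm hp' hf0_meas hf0 hA1.1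
      (r := fun i => (R (X' i ω)).toNNReal) (fun i hi => (hω i hi).2) n
  refine ⟨hn, PredictiveRecursion.tendsto_of_tendsto_lintegral_tsub ν hΘ hp_meas h1 hA3 hA2
    (fun n => PredictiveRecursion.mixingMeasure_compl hΘm _) hF ?_⟩
  refine hlim.congr fun n => ?_
  simp only [PredictiveRecursion.prDist, PredictiveRecursion.prMeasure, ProbabilityMeasure.coe_mk,
    hden]
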